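/- Let $n\in\mathbb N$ and let $Cl_n$ be the real Clifford algebra generated by $e_1,\dots,e_n$ with $e_ie_j+e_je_i=-2\delta_{ij}$, with reversion $\tilde a$, conjugation $\overline a$ (the anti-automorphism with $\overline{e_i}=-e_i$), and norm $\|a\|=(\sum_A|a_A|^2)^{1/2}$ for $a=\sum_A a_Ae_A$. Identify $(x_0,\dots,x_n)\in\mathbb R\oplus\mathbb R^n$ with the paravector $x_0+x_1e_1+\cdots+x_ne_n\in Cl_n$, and put $D=\partial_{x_0}+\sum_{i=1}^n e_i\,\partial_{x_i}$ and $\Delta=\sum_{j=0}^n\partial_{x_j}^2$. For an even integer $k\ge 0$ and an open set $U\subseteq\mathbb R\oplus\mathbb R^n$, a function $f:U\to Cl_n$ is called $k$-holomorphic Cliffordian on $U$ if it is of class $C^{k+1}$ and $D\Delta^{k/2}f=0$ on $U$. For an even integer $k<0$ the equation $D\Delta^{k/2}f=0$ is read with $\Delta^{k/2}$ as a right inverse of $\Delta^{-k/2}$: there is $g:U\to Cl_n$ of class $C^{-k}$ with $\Delta^{-k/2}g=f$ and $Dg=0$ on $U$. Let $SAV(\mathbb R\oplus\mathbb R^n)$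 be the set of matrices $M=\begin{pmatrix}a&b\\c&d\end{pmatrix}$ over $Cl_n$ such that $a,b,c,d$ are products of paravectors, $a\tilde d-b\tilde c=1$, and $ac^{-1},\,c^{-1}d\in\mathbb R\oplus\mathbb R^n$ if $c\ne0$, while $bd^{-1}\in\mathbb R\oplus\mathbb R^n$ if $c=0$. For $x\in\mathbb R\oplus\mathbb R^n$ with $cx+d\neq 0$ write $M\langle x\rangle=(ax+b)(cx+d)^{-1}\in\mathbb R\oplus\mathbb R^n$. Theorem. Let $k$ be an even integer, $M\in SAV(\mathbb R\oplus\mathbb R^n)$, $U\subseteq\mathbb R\oplus\mathbb R^n$ open, and let $f$ be $k$-holomorphic Cliffordian on $U$. Then the set $V=\{x\in\mathbb R\oplus\mathbb R^n : cx+d\ne0,\ M\langle x\rangle\in U\}$ is open and $$F(x)=\frac{\overline{cx+d}}{\|cx+d\|^{\,n+1-k}}\,f(M\langle x\rangle)$$ is $k$-holomorphic Cliffordian on $V$. -/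

import Mathlib

/-- The quadratic form `-(x₁² + ⋯ + xₙ²)` on `ℝⁿ`. -/
noncomputable def cliffordForm (n : ℕ) : QuadraticForm ℝ (Fin n → ℝ) :=
  QuadraticMap.weightedSumSquares ℝ (fun _ : Fin n => (-1 : ℝ))

/-- The real Clifford algebra `Cl_n`, with `e_i e_j + e_j e_i = -2 δ_{ij}`. -/
abbrev Cl (n : ℕ) : Type := CliffordAlgebra (cliffordForm n)

namespace Cl

open CliffordAlgebra

/-- The generator `e_{i+1}` (the index set `Fin n` starts at `0`). -/
noncomputable def e {n : ℕ} (i : Fin n) : Cl n :=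
  CliffordAlgebra.ι (cliffordForm n) (Pi.single i 1)

theorem cliffordForm_apply {n : ℕ} (v : Fin n → ℝ) : cliffordForm n v = -∑ i, v i ^ 2 := by
  simp [cliffordForm, QuadraticMap.weightedSumSquares_apply, pow_two]

theorem e_mul_e_add {n : ℕ} (i j : Fin n) :
    e i * e j + e j * e i = algebraMap ℝ (Cl n) (if i = j then -2 else 0) := by
  rw [e, e, CliffordAlgebra.ι_mul_ι_add_swap]
  congr 1
  simp only [QuadraticMap.polar, cliffordForm_apply]
  by_cases h : i = j
  · subst h
    simp only [Pi.add_apply, Pi.single_apply, if_true]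
    simp [← two_mul, Finset.sum_ite_eq', ite_pow]
    norm_num
  · have : ∀ x, ((Pi.single i 1 : Fin n → ℝ) x + (Pi.single j 1 : Fin n → ℝ) x) ^ 2
        = (Pi.single i 1 : Fin n → ℝ) x ^ 2 + (Pi.single j 1 : Fin n → ℝ) x ^ 2 := by
      intro x
      simp only [Pi.single_apply]
      split_ifs <;> simp_all
    simp [h, this, Finset.sum_add_distrib]

/-- The product `e_A = e_{j₁} ⋯ e_{jᵣ}`, where `A = {j₁ < ⋯ < jᵣ}`. -/
noncomputable def blade {n : ℕ} (A : Finset (Fin n)) : Cl n :=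
  ((A.sort (· ≤ ·)).map e).prod

theorem contractLeft_prod_eq_zero {n : ℕ} (Q : QuadraticForm ℝ (Fin n → ℝ))
    (d : Module.Dual ℝ (Fin n → ℝ)) (l : List (Fin n))
    (h : ∀ i ∈ l, d (Pi.single i 1) = 0) :
    contractLeft (Q := Q) d
      ((l.map fun i => CliffordAlgebra.ι Q (Pi.single i (1 : ℝ))).prod) = 0 := by
  induction l with
  | nil => simp
  | cons i l ih =>
    rw [List.map_cons, List.prod_cons, contractLeft_ι_mul, h i (by simp),
      ih (fun j hj => h j (by simp [hj]))]
    simp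

theorem changeForm_prod {n : ℕ} {B : LinearMap.BilinForm ℝ (Fin n → ℝ)}
    (h : B.toQuadraticMap = 0 - cliffordForm n)
    (hB : ∀ i j, i ≠ j → B (Pi.single i 1) (Pi.single j 1) = 0) (l : List (Fin n))
    (hl : l.Nodup) :
    changeForm h ((l.map e).prod) =
      (l.map fun i => CliffordAlgebra.ι (0 : QuadraticForm ℝ (Fin n → ℝ))
        (Pi.single i (1 : ℝ))).prod := by
  induction l with
  | nil => simp
  | cons i l ih =>
    rw [List.nodup_cons] at hl
    rw [List.map_cons, List.prod_cons, e, changeForm_ι_mul, ih hl.2, contractLeft_prod_eq_zero,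
      sub_zero, List.map_cons, List.prod_cons]
    intro j hj
    exact hB i j (fun hij => hl.1 (hij ▸ hj))

/-- The dot product is a bilinear form whose quadratic form is minus the form of `Cl_n`. -/
theorem exists_bilin (n : ℕ) : ∃ B : LinearMap.BilinForm ℝ (Fin n → ℝ),
    B.toQuadraticMap = 0 - cliffordForm n ∧
      ∀ i j, i ≠ j → B (Pi.single i 1) (Pi.single j 1) = 0 := by
  refine ⟨dotProductBilin ℝ ℝ, ?_, ?_⟩
  · ext v
    simp [cliffordForm_apply, dotProduct, pow_two]
  · intro i j hij
    simp [hij]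

theorem exteriorBasis_apply {n : ℕ} (A : Finset (Fin n)) :
    (Pi.basisFun ℝ (Fin n)).ExteriorAlgebra A =
      ((A.sort (· ≤ ·)).map fun i => CliffordAlgebra.ι (0 : QuadraticForm ℝ (Fin n → ℝ))
        (Pi.single i (1 : ℝ))).prod := by
  rw [ExteriorAlgebra.basis_apply_ofCard (n := A.card) _ rfl, ExteriorAlgebra.ιMulti_family,
    ExteriorAlgebra.ιMulti_apply, ← A.listMap_orderEmbOfFin_finRange rfl, List.map_map,
    List.ofFn_eq_map]
  congr 1
  apply List.map_congr_left
  intro i _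
  simp [Set.powersetCard.ofFinEmbEquiv_symm_apply]

theorem exists_bladeBasis (n : ℕ) :
    ∃ b : Module.Basis (Finset (Fin n)) ℝ (Cl n), ∀ A, b A = blade A := by
  obtain ⟨B, h, hB⟩ := exists_bilin n
  refine ⟨(Pi.basisFun ℝ (Fin n)).ExteriorAlgebra.map (changeFormEquiv h).symm, fun A => ?_⟩
  rw [Module.Basis.map_apply, LinearEquiv.symm_apply_eq, changeFormEquiv_apply, blade,
    changeForm_prod h hB _ (A.sort_nodup _), exteriorBasis_apply]

/-- The basis `(e_A)` of `Cl_n`, where `A` runs over the subsets of the index set. -/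
noncomputable def bladeBasis (n : ℕ) : Module.Basis (Finset (Fin n)) ℝ (Cl n) :=
  Module.Basis.mk (v := blade)
    (by
      obtain ⟨b, hb⟩ := exists_bladeBasis n
      have : (blade : Finset (Fin n) → Cl n) = b := funext fun A => (hb A).symm
      rw [this]
      exact b.linearIndependent)
    (by
      obtain ⟨b, hb⟩ := exists_bladeBasis n
      have : (blade : Finset (Fin n) → Cl n) = b := funext fun A => (hb A).symm
      rw [this, b.span_eq])

theorem bladeBasis_apply {n : ℕ} (A : Finset (Fin n)) : bladeBasis n A = blade A := by
  simp [bladeBasis]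

/-- The scalar components `(a_A)_A` of a Clifford number. -/
noncomputable def components (n : ℕ) : Cl n →ₗ[ℝ] EuclideanSpace ℝ (Finset (Fin n)) :=
  ((bladeBasis n).equivFun.trans (WithLp.linearEquiv 2 ℝ (Finset (Fin n) → ℝ)).symm).toLinearMap

theorem components_injective (n : ℕ) : Function.Injective (components n) :=
  LinearEquiv.injective _

theorem components_apply {n : ℕ} (a : Cl n) (A : Finset (Fin n)) :
    components n a A = (bladeBasis n).repr a A := by
  simp [components]

/-- `Cl_n` carries the norm `‖a‖ = (∑_A |a_A|²)^{1/2}`. -/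
noncomputable instance instNormedAddCommGroup (n : ℕ) : NormedAddCommGroup (Cl n) :=
  NormedAddCommGroup.induced (Cl n) (EuclideanSpace ℝ (Finset (Fin n))) (components n)
    (components_injective n)

noncomputable instance instNormedSpace (n : ℕ) : NormedSpace ℝ (Cl n) :=
  NormedSpace.induced ℝ (Cl n) (EuclideanSpace ℝ (Finset (Fin n))) (components n)

theorem norm_eq {n : ℕ} (a : Cl n) :
    ‖a‖ = Real.sqrt (∑ A, |(bladeBasis n).repr a A| ^ 2) := by
  change ‖components n a‖ = _
  rw [EuclideanSpace.norm_eq]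
  simp [components_apply]

/-- The embedding `(x₀, …, xₙ) ↦ x₀ + x₁ e₁ + ⋯ + xₙ eₙ` of `ℝ ⊕ ℝⁿ` into `Cl_n`; the elements
of its range are the paravectors. -/
noncomputable def para {n : ℕ} : EuclideanSpace ℝ (Fin (n + 1)) →ₗ[ℝ] Cl n where
  toFun x := algebraMap ℝ (Cl n) (x 0) + ∑ i : Fin n, x i.succ • e i
  map_add' x y := by
    simp only [PiLp.add_apply, map_add, add_smul, Finset.sum_add_distrib]
    abel
  map_smul' r x := by
    simp [Algebra.algebraMap_eq_smul_one, mul_smul, Finset.smul_sum]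

theorem para_apply {n : ℕ} (x : EuclideanSpace ℝ (Fin (n + 1))) :
    para x = algebraMap ℝ (Cl n) (x 0) + ∑ i : Fin n, x i.succ • e i := rfl

/-- The paravector part `(a_∅, a_{1}, …, a_{n})` of a Clifford number `a`. -/
noncomputable def paraPart {n : ℕ} (a : Cl n) : EuclideanSpace ℝ (Fin (n + 1)) :=
  WithLp.toLp 2 (Fin.cons ((bladeBasis n).repr a ∅) fun i => (bladeBasis n).repr a {i})

theorem blade_empty {n : ℕ} : (blade ∅ : Cl n) = 1 := by simp [blade]

theorem blade_singleton {n : ℕ} (i : Fin n) : blade {i} = e i := by simp [blade]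

theorem paraPart_para {n : ℕ} (x : EuclideanSpace ℝ (Fin (n + 1))) : paraPart (para x) = x := by
  have h : para x = x 0 • bladeBasis n ∅ + ∑ i : Fin n, x i.succ • bladeBasis n {i} := by
    simp [para_apply, bladeBasis_apply, blade_empty, blade_singleton, Algebra.algebraMap_eq_smul_one]
  ext j
  refine Fin.cases ?_ (fun i => ?_) j
  · simp [paraPart, h, Finsupp.single_apply]
  · simp [paraPart, h, Finsupp.single_apply]

/-- Reversion `ã`. -/
noncomputable def rev {n : ℕ} (a : Cl n) : Cl n := CliffordAlgebra.reverse a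

/-- A Clifford number is a product of paravectors. -/
def IsParaProd {n : ℕ} (a : Cl n) : Prop :=
  ∃ l : List (EuclideanSpace ℝ (Fin (n + 1))), a = (l.map para).prod

/-- `M = (a, b; c, d)` belongs to the general Ahlfors-Vahlen group `GAV(ℝ ⊕ ℝⁿ)`. -/
structure IsGAV {n : ℕ} (M : Matrix (Fin 2) (Fin 2) (Cl n)) : Prop where
  prod_para : ∀ i j, IsParaProd (M i j)
  det_real : ∃ r : ℝ, r ≠ 0 ∧
    M 0 0 * rev (M 1 1) - M 0 1 * rev (M 1 0) = algebraMap ℝ (Cl n) r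
  para_of_ne : M 1 0 ≠ 0 → M 0 0 * Ring.inverse (M 1 0) ∈ LinearMap.range (para (n := n)) ∧
    Ring.inverse (M 1 0) * M 1 1 ∈ LinearMap.range (para (n := n))
  para_of_eq : M 1 0 = 0 → M 0 1 * Ring.inverse (M 1 1) ∈ LinearMap.range (para (n := n))

/-- The special Ahlfors-Vahlen group `SAV(ℝ ⊕ ℝⁿ)`. -/
def SAV (n : ℕ) : Set (Matrix (Fin 2) (Fin 2) (Cl n)) :=
  {M | IsGAV M ∧ M 0 0 * rev (M 1 1) - M 0 1 * rev (M 1 0) = 1}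

/-- The denominator `cx + d`. -/
noncomputable def denom {n : ℕ} (M : Matrix (Fin 2) (Fin 2) (Cl n))
    (x : EuclideanSpace ℝ (Fin (n + 1))) : Cl n :=
  M 1 0 * para x + M 1 1

/-- The Möbius transformation `M<x> = (ax + b)(cx + d)⁻¹`, as a point of `ℝ ⊕ ℝⁿ`. -/
noncomputable def moebius {n : ℕ} (M : Matrix (Fin 2) (Fin 2) (Cl n))
    (x : EuclideanSpace ℝ (Fin (n + 1))) : EuclideanSpace ℝ (Fin (n + 1)) :=
  paraPart ((M 0 0 * para x + M 0 1) * Ring.inverse (denom M x))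

/-! Facts showing that `moebius` is well defined. -/

theorem para_eq {n : ℕ} (x : EuclideanSpace ℝ (Fin (n + 1))) :
    para x = algebraMap ℝ (Cl n) (x 0) +
      CliffordAlgebra.ι (cliffordForm n) (fun i : Fin n => x i.succ) := by
  rw [para_apply]
  conv_rhs => rw [pi_eq_sum_univ' (fun i : Fin n => x i.succ)]
  simp [e]

theorem rev_para {n : ℕ} (x : EuclideanSpace ℝ (Fin (n + 1))) :
    rev (para x : Cl n) = para x := by
  simp [rev, para_eq]

theorem star_para_mem {n : ℕ} (x : EuclideanSpace ℝ (Fin (n + 1))) :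
    star (para x : Cl n) ∈ LinearMap.range (para (n := n)) := by
  refine ⟨WithLp.toLp 2 (Fin.cons (x 0) fun i => -x i.succ), ?_⟩
  simp [para_apply, e]

theorem para_mul_star {n : ℕ} (x : EuclideanSpace ℝ (Fin (n + 1))) :
    para x * star (para x : Cl n) = algebraMap ℝ (Cl n) (‖x‖ ^ 2) := by
  have h := CliffordAlgebra.ι_sq_scalar (cliffordForm n) (fun i : Fin n => x i.succ)
  have hn : ‖x‖ ^ 2 = x 0 * x 0 - cliffordForm n (fun i : Fin n => x i.succ) := by
    rw [EuclideanSpace.norm_sq_eq, Fin.sum_univ_succ, cliffordForm_apply]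
    simp [pow_two]
  rw [para_eq, star_add, star_algebraMap, star_ι, hn, map_sub, map_mul, ← h]
  have hc := Algebra.commutes (x 0)
    (CliffordAlgebra.ι (cliffordForm n) (fun i : Fin n => x i.succ))
  simp only [add_mul, mul_add, mul_neg, hc]
  abel

theorem star_mul_para {n : ℕ} (x : EuclideanSpace ℝ (Fin (n + 1))) :
    star (para x : Cl n) * para x = algebraMap ℝ (Cl n) (‖x‖ ^ 2) := by
  obtain ⟨y, hy⟩ := star_para_mem x
  have h := para_mul_star y
  rw [hy, star_star] at h
  rw [h]
  have h1 := para_mul_star x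
  have hx : x = WithLp.toLp 2 (Fin.cons (y 0) fun i => -y i.succ) := by
    have : para (WithLp.toLp 2 (Fin.cons (y 0) fun i => -y i.succ)) = (para x : Cl n) := by
      rw [← star_star (para x : Cl n), ← hy]
      simp [para_apply, e]
    rw [← paraPart_para x, ← this, paraPart_para]
  rw [hx]
  simp [EuclideanSpace.norm_sq_eq, Fin.sum_univ_succ]

theorem para_inv {n : ℕ} (x : EuclideanSpace ℝ (Fin (n + 1))) (hx : x ≠ 0) :
    ∃ y : EuclideanSpace ℝ (Fin (n + 1)),
      (para x : Cl n) * para y = 1 ∧ (para y : Cl n) * para x = 1 := by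
  obtain ⟨y, hy⟩ := star_para_mem x
  have h : ‖x‖ ^ 2 ≠ 0 := by simpa using hx
  have h1 : (‖x‖ ^ 2)⁻¹ • algebraMap ℝ (Cl n) (‖x‖ ^ 2) = 1 := by
    rw [Algebra.algebraMap_eq_smul_one, smul_smul, inv_mul_cancel₀ h, one_smul]
  refine ⟨(‖x‖ ^ 2)⁻¹ • y, ?_, ?_⟩
  · rw [map_smul, hy, mul_smul_comm, para_mul_star, h1]
  · rw [map_smul, hy, smul_mul_assoc, star_mul_para, h1]

theorem para_sandwich {n : ℕ} (p x : EuclideanSpace ℝ (Fin (n + 1))) :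
    (para p : Cl n) * para x * para p ∈ LinearMap.range (para (n := n)) := by
  obtain ⟨y, hy⟩ := star_para_mem x
  have hy' : star (para y : Cl n) = para x := by rw [hy, star_star]
  have h := para_mul_star (p + y)
  rw [map_add, star_add, hy', add_mul, mul_add, mul_add, para_mul_star, ← hy', para_mul_star,
    hy'] at h
  have h2 : (para p : Cl n) * para x * para p =
      (‖p + y‖ ^ 2 - ‖p‖ ^ 2 - ‖y‖ ^ 2) • para p - (‖p‖ ^ 2) • para y := by
    have h3 : (para p : Cl n) * para x = algebraMap ℝ (Cl n) (‖p + y‖ ^ 2 - ‖p‖ ^ 2 - ‖y‖ ^ 2)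
        - para y * star (para p) := by
      rw [map_sub, map_sub, ← h]
      abel
    rw [h3, sub_mul, mul_assoc, star_mul_para, ← Algebra.smul_def, ← Algebra.commutes,
      ← Algebra.smul_def]
  rw [h2]
  exact Submodule.sub_mem _ (Submodule.smul_mem _ _ ⟨_, rfl⟩) (Submodule.smul_mem _ _ ⟨_, rfl⟩)

theorem rev_mul {n : ℕ} (a b : Cl n) : rev (a * b) = rev b * rev a :=
  CliffordAlgebra.reverse.map_mul a b

/-- A non-zero product of paravectors is invertible, and the twisted conjugation by it preserves
paravectors. -/
theorem IsParaProd.inv {n : ℕ} {c : Cl n} (hc : IsParaProd c) (h0 : c ≠ 0) :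
    ∃ c' : Cl n, c * c' = 1 ∧ c' * c = 1 ∧ ∀ x : EuclideanSpace ℝ (Fin (n + 1)),
      rev c' * para x * c' ∈ LinearMap.range (para (n := n)) := by
  obtain ⟨l, rfl⟩ := hc
  induction l with
  | nil => exact ⟨1, by simp, by simp, fun x => by simp [rev]⟩
  | cons p l ih =>
    rw [List.map_cons, List.prod_cons] at h0 ⊢
    obtain ⟨c', h1, h2, h3⟩ := ih (right_ne_zero_of_mul h0)
    have hp : p ≠ 0 := by
      rintro rfl
      simp at h0
    obtain ⟨q, hq1, hq2⟩ := para_inv p hp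
    refine ⟨c' * para q, ?_, ?_, fun x => ?_⟩
    · rw [mul_assoc, ← mul_assoc _ c', h1, one_mul, hq1]
    · rw [mul_assoc, ← mul_assoc (para q), hq2, one_mul, h2]
    · obtain ⟨y, hy⟩ := h3 x
      have := para_sandwich q y
      rw [hy] at this
      rw [rev_mul, rev_para]
      simpa only [mul_assoc] using this

theorem ring_inverse_eq {n : ℕ} {c c' : Cl n} (h1 : c * c' = 1) (h2 : c' * c = 1) :
    Ring.inverse c = c' :=
  Ring.inverse_unit (⟨c, c', h1, h2⟩ : (Cl n)ˣ)

theorem rev_mul_rev_eq_one {n : ℕ} {a b : Cl n} (h : a * b = 1) : rev b * rev a = 1 := by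
  rw [← rev_mul, h]
  simp [rev]

/-- For `M` in `GAV(ℝ ⊕ ℝⁿ)` and `cx + d ≠ 0`, the Clifford number `cx + d` is invertible and
`(ax + b)(cx + d)⁻¹` is a paravector. -/
theorem para_moebius {n : ℕ} {M : Matrix (Fin 2) (Fin 2) (Cl n)} (hM : IsGAV M)
    {x : EuclideanSpace ℝ (Fin (n + 1))} (hx : denom M x ≠ 0) :
    IsUnit (denom M x) ∧
      para (moebius M x) = (M 0 0 * para x + M 0 1) * Ring.inverse (denom M x) := by
  suffices h : IsUnit (denom M x) ∧
      (M 0 0 * para x + M 0 1) * Ring.inverse (denom M x) ∈ LinearMap.range (para (n := n)) by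
    refine ⟨h.1, ?_⟩
    obtain ⟨y, hy⟩ := h.2
    rw [moebius, ← hy, paraPart_para]
  obtain ⟨r, hr, hdet⟩ := hM.det_real
  by_cases hc : M 1 0 = 0
  · have hd : denom M x = M 1 1 := by simp [denom, hc]
    rw [hd] at hx ⊢
    obtain ⟨d', h1, h2, h3⟩ := (hM.prod_para 1 1).inv hx
    refine ⟨⟨⟨_, d', h1, h2⟩, rfl⟩, ?_⟩
    have hb := hM.para_of_eq hc
    rw [add_mul]
    refine Submodule.add_mem _ ?_ hb
    rw [ring_inverse_eq h1 h2]
    have ha : M 0 0 = r • rev d' := by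
      have hz : rev (0 : Cl n) = 0 := by simp [rev]
      rw [hc, hz, mul_zero, sub_zero] at hdet
      calc M 0 0 = M 0 0 * rev (M 1 1) * rev d' := by
            rw [mul_assoc, rev_mul_rev_eq_one h2, mul_one]
        _ = _ := by rw [hdet, ← Algebra.smul_def]
    rw [ha, smul_mul_assoc, smul_mul_assoc]
    exact Submodule.smul_mem _ _ (h3 x)
  · obtain ⟨c', h1, h2, h3⟩ := (hM.prod_para 1 0).inv hc
    obtain ⟨⟨m, hm⟩, ⟨w, hw⟩⟩ := hM.para_of_ne hc
    rw [ring_inverse_eq h1 h2] at hm hw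
    have hd : M 1 1 = M 1 0 * para w := by rw [hw, ← mul_assoc, h1, one_mul]
    have hden : denom M x = M 1 0 * para (x + w) := by rw [denom, map_add, mul_add, ← hd]
    have hu : x + w ≠ 0 := by
      intro h
      rw [hden, h] at hx
      simp at hx
    obtain ⟨v, hv1, hv2⟩ := para_inv _ hu
    have i1 : denom M x * (para v * c') = 1 := by
      rw [hden, mul_assoc, ← mul_assoc (para (x + w)), hv1, one_mul, h1]
    have i2 : para v * c' * denom M x = 1 := by
      rw [hden, mul_assoc, ← mul_assoc c', h2, one_mul, hv2]
    refine ⟨⟨⟨_, _, i1, i2⟩, rfl⟩, ?_⟩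
    rw [ring_inverse_eq i1 i2]
    have hb : M 0 1 = M 0 0 * para w - r • rev c' := by
      rw [hd, rev_mul, rev_para] at hdet
      have : (M 0 0 * para w - M 0 1) * rev (M 1 0) * rev c' = r • rev c' := by
        rw [sub_mul, mul_assoc (M 0 0), hdet, ← Algebra.smul_def]
      rw [mul_assoc, rev_mul_rev_eq_one h2, mul_one] at this
      rw [← this]
      abel
    have hfin : (M 0 0 * para x + M 0 1) * (para v * c') =
        para m - r • (rev c' * para v * c') := by
      have : M 0 0 * para x + M 0 1 = M 0 0 * para (x + w) - r • rev c' := by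
        rw [hb, map_add, mul_add]
        abel
      rw [this, sub_mul, mul_assoc, ← mul_assoc (para (x + w)), hv1, one_mul, hm,
        smul_mul_assoc, ← mul_assoc]
    rw [hfin]
    exact Submodule.sub_mem _ ⟨_, rfl⟩ (Submodule.smul_mem _ _ (h3 v))

/-! Differential operators. -/

/-- The operator `D f = ∂f/∂x₀ + e₁ ∂f/∂x₁ + ⋯ + eₙ ∂f/∂xₙ`. -/
noncomputable def dirac {n : ℕ} (f : EuclideanSpace ℝ (Fin (n + 1)) → Cl n)
    (x : EuclideanSpace ℝ (Fin (n + 1))) : Cl n :=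
  ∑ j : Fin (n + 1), para (EuclideanSpace.single j 1) *
    fderiv ℝ f x (EuclideanSpace.single j 1)

/-- The `m`-th power of the Laplacian `Δ = ∂²/∂x₀² + ⋯ + ∂²/∂xₙ²`. -/
noncomputable def laplacePow {n : ℕ} (m : ℕ) (f : EuclideanSpace ℝ (Fin (n + 1)) → Cl n) :
    EuclideanSpace ℝ (Fin (n + 1)) → Cl n :=
  (Laplacian.laplacian : (EuclideanSpace ℝ (Fin (n + 1)) → Cl n) →
    EuclideanSpace ℝ (Fin (n + 1)) → Cl n)^[m] f

/-- `f` is `k`-holomorphic Cliffordian on the open set `U`, for an even integer `k`: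
`D Δ^{k/2} f = 0` on `U`. For `k < 0`, `Δ^{k/2}` is a right inverse of `Δ^{-k/2}`: `Δ^{k/2} f`
stands for a function `g` with `Δ^{-k/2} g = f`. -/
def IsKHolomorphicCliffordian {n : ℕ} (k : ℤ) (U : Set (EuclideanSpace ℝ (Fin (n + 1))))
    (f : EuclideanSpace ℝ (Fin (n + 1)) → Cl n) : Prop :=
  IsOpen U ∧
    ((0 ≤ k ∧ ContDiffOn ℝ (k.toNat + 1 : ℕ) f U ∧
        ∀ x ∈ U, dirac (laplacePow (k / 2).toNat f) x = 0) ∨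
      (k < 0 ∧ ∃ g : EuclideanSpace ℝ (Fin (n + 1)) → Cl n,
        ContDiffOn ℝ ((-k).toNat : ℕ) g U ∧
        (∀ x ∈ U, laplacePow (-k / 2).toNat g x = f x) ∧ ∀ x ∈ U, dirac g x = 0))

end Cl

/-! Write N = n + 1, ē_j for the conjugate units and D̄ = ∑ ē_j ∂_j, so that D D̄ = D̄ D = Δ.

If k < 0, then g with Dg = 0 is harmonic, so f = Δ^{-k/2} g = 0 because at least one Laplacian is
applied; both sides of the transformation law vanish and only openness of V remains.

If k = 2m ≥ 0, the map M<x> is affine and conformal when c = 0. When c ≠ 0 it is x ↦ T((x + w)*) + t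
with x* = x/‖x‖² and T linear conformal, and cx + d = c(x + w). A conformal T preserves traces of
bilinear forms up to r², so a Clifford factor intertwining the units with their images under T
carries solutions to solutions (`diracWith_comp_conformal`).

The heart is the inversion. Put K_s h(x) = ‖x‖^s h(x*). Then D Δ^m (x̄ K_{2m-N} h) = -K_{-2m-N}(y D̄
Δ^m h), where y is the variable of h (`dirac_laplacian_iterate_star_para_mul_kelvin`). Three
identities give it: Δ^m K_{2m-N} = K_{-2m-N} Δ^m (`laplacian_iterate_kelvin`), D(x̄ K_s h) = K_s((s
+ N)h - y D̄h), and Δ^m(y D̄h) = y D̄Δ^m h + 2m Δ^m h. For s = 2m - N the two terms 2m Δ^m h cancel.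
The inversion thus exchanges D and D̄, and T, which contains a conjugation, exchanges them back. The
weight in F splits because ‖c(x + w)‖ = ‖c‖ ‖x + w‖ (`norm_mul_para`). -/

set_option linter.unusedSectionVars false

/-! ### Partial derivatives, the Euler operator E, and commutators with powers of the Laplacian. -/

section PartialDerivatives

open Laplacian Set

variable {ι : Type*} [Fintype ι] [DecidableEq ι]
  {G : Type*} [NormedAddCommGroup G] [NormedSpace ℝ G]

/-- The partial derivative in the direction of the `i`-th coordinate. -/
noncomputable def pderivAt (i : ι) (f : EuclideanSpace ℝ ι → G) : EuclideanSpace ℝ ι → G :=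
  fun x => fderiv ℝ f x (EuclideanSpace.single i 1)

/-- The Euler operator `∑ i, x i • ∂ᵢ f`. -/
noncomputable def euler (f : EuclideanSpace ℝ ι → G) : EuclideanSpace ℝ ι → G :=
  fun x => ∑ i, x i • pderivAt i f x

variable {U : Set (EuclideanSpace ℝ ι)} {f g : EuclideanSpace ℝ ι → G} {k m : ℕ}

theorem ContDiffOn.differentiableAt_of_isOpen (hU : IsOpen U) (hf : ContDiffOn ℝ (k + 1 : ℕ) f U)
    {x : EuclideanSpace ℝ ι} (hx : x ∈ U) : DifferentiableAt ℝ f x :=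
  (hf.contDiffAt (hU.mem_nhds hx)).differentiableAt (by simp)

theorem ContDiffOn.pderivAt (hU : IsOpen U) (hf : ContDiffOn ℝ (k + 1 : ℕ) f U) (i : ι) :
    ContDiffOn ℝ k (pderivAt i f) U :=
  (hf.fderiv_of_isOpen hU (by simp)).clm_apply contDiffOn_const

theorem ContDiffOn.of_nat_le (hf : ContDiffOn ℝ k f U) (h : m ≤ k) : ContDiffOn ℝ m f U :=
  hf.of_le (by exact_mod_cast h)

theorem contDiffOn_coord (i : ι) : ContDiffOn ℝ k (fun x : EuclideanSpace ℝ ι => x i) U :=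
  (EuclideanSpace.proj (𝕜 := ℝ) i).contDiff.contDiffOn

theorem ContDiffOn.euler (hU : IsOpen U) (hf : ContDiffOn ℝ (k + 1 : ℕ) f U) :
    ContDiffOn ℝ k (euler f) U :=
  ContDiffOn.sum fun i _ => (contDiffOn_coord i).smul (hf.pderivAt hU i)

theorem pderivAt_congr (hU : IsOpen U) (h : EqOn f g U) (i : ι) :
    EqOn (pderivAt i f) (pderivAt i g) U := fun x hx => by
  rw [pderivAt, pderivAt, (h.eventuallyEq_of_mem (hU.mem_nhds hx)).fderiv_eq]

theorem laplacian_congr (hU : IsOpen U) (h : EqOn f g U) : EqOn (Δ f) (Δ g) U := fun _ hx =>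
  (InnerProductSpace.laplacian_congr_nhds (h.eventuallyEq_of_mem (hU.mem_nhds hx))).eq_of_nhds

theorem laplacian_iterate_congr (hU : IsOpen U) (m : ℕ) (h : EqOn f g U) :
    EqOn (Δ^[m] f) (Δ^[m] g) U := by
  induction m generalizing f g with
  | zero => exact h
  | succ m ih => exact ih (laplacian_congr hU h)

theorem fderiv_eq_sum_pderivAt (f : EuclideanSpace ℝ ι → G) (x v : EuclideanSpace ℝ ι) :
    fderiv ℝ f x v = ∑ i, v i • pderivAt i f x := by
  conv_lhs => rw [← (EuclideanSpace.basisFun ι ℝ).sum_repr v]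
  simp [pderivAt]

theorem pderivAt_comp_clm {H : Type*} [NormedAddCommGroup H] [NormedSpace ℝ H] (L : G →L[ℝ] H)
    (i : ι) {x : EuclideanSpace ℝ ι} (hf : DifferentiableAt ℝ f x) :
    pderivAt i (fun y => L (f y)) x = L (pderivAt i f x) := by
  have := (L.hasFDerivAt (x := f x)).comp x hf.hasFDerivAt
  rw [pderivAt, show (fun y => L (f y)) = L ∘ f from rfl, this.fderiv]
  rfl

theorem pderivAt_add (i : ι) {x : EuclideanSpace ℝ ι} (hf : DifferentiableAt ℝ f x)
    (hg : DifferentiableAt ℝ g x) :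
    pderivAt i (fun y => f y + g y) x = pderivAt i f x + pderivAt i g x := by
  simp [pderivAt, fderiv_fun_add hf hg]

theorem pderivAt_sub (i : ι) {x : EuclideanSpace ℝ ι} (hf : DifferentiableAt ℝ f x)
    (hg : DifferentiableAt ℝ g x) :
    pderivAt i (fun y => f y - g y) x = pderivAt i f x - pderivAt i g x := by
  simp [pderivAt, fderiv_fun_sub hf hg]

theorem pderivAt_sum {κ : Type*} (s : Finset κ) {F : κ → EuclideanSpace ℝ ι → G} (i : ι)
    {x : EuclideanSpace ℝ ι} (hF : ∀ j ∈ s, DifferentiableAt ℝ (F j) x) :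
    pderivAt i (fun y => ∑ j ∈ s, F j y) x = ∑ j ∈ s, pderivAt i (F j) x := by
  simp [pderivAt, fderiv_fun_sum hF]

theorem pderivAt_const_smul (c : ℝ) (i : ι) (x : EuclideanSpace ℝ ι) :
    pderivAt i (fun y => c • f y) x = c • pderivAt i f x := by
  have h : (fun y => c • f y) = c • f := rfl
  simp [pderivAt, h, fderiv_const_smul_field]

theorem pderivAt_smul (i : ι) {φ : EuclideanSpace ℝ ι → ℝ} {x : EuclideanSpace ℝ ι}
    (hφ : DifferentiableAt ℝ φ x) (hf : DifferentiableAt ℝ f x) :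
    pderivAt i (fun y => φ y • f y) x = pderivAt i φ x • f x + φ x • pderivAt i f x := by
  simp [pderivAt, fderiv_fun_smul hφ hf, add_comm]

theorem differentiableAt_coord (j : ι) (x : EuclideanSpace ℝ ι) :
    DifferentiableAt ℝ (fun y : EuclideanSpace ℝ ι => y j) x :=
  (EuclideanSpace.proj (𝕜 := ℝ) j).differentiableAt

theorem pderivAt_coord (i j : ι) (x : EuclideanSpace ℝ ι) :
    pderivAt i (fun y : EuclideanSpace ℝ ι => y j) x = if j = i then 1 else 0 := by
  let L : EuclideanSpace ℝ ι →L[ℝ] ℝ := EuclideanSpace.proj j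
  have h : (fun y : EuclideanSpace ℝ ι => y j) = L := rfl
  rw [pderivAt, h, L.fderiv]
  simp [L]

theorem DifferentiableAt.coord_smul (j : ι) {x : EuclideanSpace ℝ ι}
    (hf : DifferentiableAt ℝ f x) : DifferentiableAt ℝ (fun y => y j • f y) x :=
  (differentiableAt_coord j x).smul hf

theorem ContDiffOn.coord_smul (j : ι) (hf : ContDiffOn ℝ k f U) :
    ContDiffOn ℝ k (fun x => x j • f x) U :=
  (contDiffOn_coord j).smul hf

theorem pderivAt_coord_smul (i j : ι) {x : EuclideanSpace ℝ ι} (hf : DifferentiableAt ℝ f x) :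
    pderivAt i (fun y => y j • f y) x = (if j = i then f x else 0) + x j • pderivAt i f x := by
  rw [pderivAt_smul i (differentiableAt_coord j x) hf, pderivAt_coord]
  simp

theorem pderivAt_comm (hU : IsOpen U) (hf : ContDiffOn ℝ (2 : ℕ) f U) (i j : ι) :
    EqOn (pderivAt i (pderivAt j f)) (pderivAt j (pderivAt i f)) U := fun x hx => by
  have hfx := hf.contDiffAt (hU.mem_nhds hx)
  have hd : DifferentiableAt ℝ (fderiv ℝ f) x :=
    (hfx.fderiv_right (m := 1) (by norm_cast)).differentiableAt (by simp)
  have h (a b : ι) : pderivAt a (pderivAt b f) x =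
      fderiv ℝ (fderiv ℝ f) x (EuclideanSpace.single a 1) (EuclideanSpace.single b 1) := by
    unfold pderivAt
    rw [fderiv_clm_apply hd (differentiableAt_const _)]
    simp
  rw [h, h]
  exact (hfx.isSymmSndFDerivAt (by simp)).eq _ _

theorem laplacian_eqOn (hU : IsOpen U) (hf : ContDiffOn ℝ (2 : ℕ) f U) :
    EqOn (Δ f) (fun x => ∑ i, pderivAt i (pderivAt i f) x) U := fun x hx => by
  have hfx := hf.contDiffAt (hU.mem_nhds hx)
  have hd : DifferentiableAt ℝ (fderiv ℝ f) x :=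
    (hfx.fderiv_right (m := 1) (by norm_cast)).differentiableAt (by simp)
  rw [InnerProductSpace.laplacian_eq_iteratedFDeriv_orthonormalBasis f
    (EuclideanSpace.basisFun ι ℝ)]
  refine Finset.sum_congr rfl fun i _ => ?_
  unfold pderivAt
  rw [iteratedFDeriv_two_apply, fderiv_clm_apply hd (differentiableAt_const _)]
  simp

theorem ContDiffOn.laplacian (hU : IsOpen U) (hf : ContDiffOn ℝ (k + 2 : ℕ) f U) :
    ContDiffOn ℝ k (Δ f) U :=
  (ContDiffOn.sum fun i _ => ContDiffOn.pderivAt hU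
    (ContDiffOn.pderivAt (k := k + 1) hU hf i) i).congr
    (laplacian_eqOn hU (hf.of_nat_le (by omega)))

theorem ContDiffOn.laplacian_iterate (hU : IsOpen U) (hf : ContDiffOn ℝ (k + 2 * m : ℕ) f U) :
    ContDiffOn ℝ k (Δ^[m] f) U := by
  induction m generalizing f with
  | zero => exact hf
  | succ m ih => exact ih (hf.laplacian hU)

theorem laplacian_add (hU : IsOpen U) (hf : ContDiffOn ℝ (2 : ℕ) f U)
    (hg : ContDiffOn ℝ (2 : ℕ) g U) :
    EqOn (Δ fun x => f x + g x) (fun x => Δ f x + Δ g x) U := fun _ hx =>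
  (hf.contDiffAt (hU.mem_nhds hx)).laplacian_add (hg.contDiffAt (hU.mem_nhds hx))

theorem laplacian_comp_clm {H : Type*} [NormedAddCommGroup H] [NormedSpace ℝ H] (L : G →L[ℝ] H)
    (hU : IsOpen U) (hf : ContDiffOn ℝ (2 : ℕ) f U) :
    EqOn (Δ fun x => L (f x)) (fun x => L (Δ f x)) U := fun _ hx =>
  (hf.contDiffAt (hU.mem_nhds hx)).laplacian_CLM_comp_left

theorem laplacian_sum {κ : Type*} (s : Finset κ) {F : κ → EuclideanSpace ℝ ι → G} (hU : IsOpen U)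
    (hF : ∀ j ∈ s, ContDiffOn ℝ (2 : ℕ) (F j) U) :
    EqOn (Δ fun x => ∑ j ∈ s, F j x) (fun x => ∑ j ∈ s, Δ (F j) x) U := by
  classical
  induction s using Finset.induction_on with
  | empty => intro x _; simp
  | insert j s hj ih =>
    intro x hx
    simp only [Finset.sum_insert hj]
    rw [laplacian_add hU (hF j (by simp)) (ContDiffOn.sum fun i hi => hF i (by simp [hi])) hx]
    beta_reduce
    rw [ih (fun i hi => hF i (by simp [hi])) hx]

theorem laplacian_iterate_add (hU : IsOpen U) (hf : ContDiffOn ℝ (2 * m : ℕ) f U)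
    (hg : ContDiffOn ℝ (2 * m : ℕ) g U) :
    EqOn (Δ^[m] fun x => f x + g x) (fun x => Δ^[m] f x + Δ^[m] g x) U := by
  induction m generalizing f g with
  | zero => exact fun x _ => rfl
  | succ m ih =>
    refine (laplacian_iterate_congr hU m
      (laplacian_add hU (hf.of_nat_le (by omega)) (hg.of_nat_le (by omega)))).trans ?_
    exact ih (hf.laplacian hU) (hg.laplacian hU)

theorem laplacian_iterate_comp_clm {H : Type*} [NormedAddCommGroup H] [NormedSpace ℝ H]
    (L : G →L[ℝ] H) (hU : IsOpen U) (hf : ContDiffOn ℝ (2 * m : ℕ) f U) :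
    EqOn (Δ^[m] fun x => L (f x)) (fun x => L (Δ^[m] f x)) U := by
  induction m generalizing f with
  | zero => exact fun x _ => rfl
  | succ m ih =>
    exact (laplacian_iterate_congr hU m (laplacian_comp_clm L hU (hf.of_nat_le (by omega)))).trans
      (ih (hf.laplacian hU))

theorem laplacian_iterate_const_smul (c : ℝ) (hU : IsOpen U)
    (hf : ContDiffOn ℝ (2 * m : ℕ) f U) :
    EqOn (Δ^[m] fun x => c • f x) (fun x => c • Δ^[m] f x) U :=
  laplacian_iterate_comp_clm (c • ContinuousLinearMap.id ℝ G) hU hf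

theorem laplacian_pderivAt (hU : IsOpen U) (hf : ContDiffOn ℝ (3 : ℕ) f U) (j : ι) :
    EqOn (Δ (pderivAt j f)) (pderivAt j (Δ f)) U := fun x hx => by
  rw [laplacian_eqOn hU (ContDiffOn.pderivAt (k := 2) hU hf j) hx,
    pderivAt_congr hU (laplacian_eqOn hU (hf.of_nat_le (by omega))) j hx, pderivAt_sum]
  · refine Finset.sum_congr rfl fun i _ => ?_
    rw [pderivAt_congr hU (pderivAt_comm hU (hf.of_nat_le (by omega)) i j) i hx,
      pderivAt_comm hU (ContDiffOn.pderivAt (k := 2) hU hf i) i j hx]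
  · exact fun i _ => ContDiffOn.differentiableAt_of_isOpen (k := 0) hU
      (ContDiffOn.pderivAt (k := 1) hU (ContDiffOn.pderivAt (k := 2) hU hf i) i) hx

/-- The commutator [Δ, x_j] = 2∂_j, from which the commutators of Δ with E, ‖x‖² and the paravector
variable are all derived. -/
theorem laplacian_coord_smul (hU : IsOpen U) (hf : ContDiffOn ℝ (2 : ℕ) f U) (j : ι) :
    EqOn (Δ fun x => x j • f x) (fun x => x j • Δ f x + (2 : ℝ) • pderivAt j f x) U := by
  intro x hx
  have hd : ∀ y ∈ U, DifferentiableAt ℝ f y := fun y hy =>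
    ContDiffOn.differentiableAt_of_isOpen (k := 1) hU hf hy
  have hd' (i : ι) : DifferentiableAt ℝ (pderivAt i f) x :=
    ContDiffOn.differentiableAt_of_isOpen (k := 0) hU (ContDiffOn.pderivAt (k := 1) hU hf i) hx
  have h1 (i : ι) : pderivAt i (pderivAt i fun y => y j • f y) x =
      x j • pderivAt i (pderivAt i f) x + if j = i then (2 : ℝ) • pderivAt j f x else 0 := by
    have h2 : EqOn (pderivAt i fun y => y j • f y)
        (fun y => (if j = i then f y else 0) + y j • pderivAt i f y) U := fun y hy =>
      pderivAt_coord_smul i j (hd y hy)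
    rw [pderivAt_congr hU h2 i hx]
    by_cases hji : j = i
    · subst hji
      simp only [if_true]
      rw [pderivAt_add j (hd x hx) ((hd' j).coord_smul j),
        pderivAt_coord_smul j j (hd' j)]
      simp only [if_true]
      module
    · simp only [hji, if_false, zero_add, add_zero]
      rw [pderivAt_coord_smul i j (hd' i)]
      simp [hji]
  rw [laplacian_eqOn hU (hf.coord_smul j) hx]
  beta_reduce
  rw [laplacian_eqOn hU hf hx]
  simp [h1, Finset.sum_add_distrib, Finset.smul_sum]

theorem laplacian_euler (hU : IsOpen U) (hf : ContDiffOn ℝ (3 : ℕ) f U) :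
    EqOn (Δ (euler f)) (fun x => euler (Δ f) x + (2 : ℝ) • Δ f x) U := by
  intro x hx
  have hp (j : ι) : ContDiffOn ℝ (2 : ℕ) (pderivAt j f) U := ContDiffOn.pderivAt (k := 2) hU hf j
  unfold euler
  rw [laplacian_sum _ hU (fun j _ => (hp j).coord_smul j) hx]
  beta_reduce
  rw [Finset.sum_congr rfl fun j _ => laplacian_coord_smul hU (hp j) j hx]
  rw [Finset.sum_add_distrib, laplacian_eqOn hU (hf.of_nat_le (by omega)) hx, Finset.smul_sum]
  congr 1
  exact Finset.sum_congr rfl fun j _ => by rw [laplacian_pderivAt hU hf j hx]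

theorem norm_sq_smul_eq_sum (x : EuclideanSpace ℝ ι) (v : G) :
    ‖x‖ ^ 2 • v = ∑ i, x i • x i • v := by
  rw [EuclideanSpace.norm_sq_eq, Finset.sum_smul]
  simp [smul_smul, pow_two]

/-- Applying [Δ, x_j] = 2∂_j twice to x_j² and summing over j gives [Δ, ‖x‖²] = 4E + 2N, with N the
dimension. -/
theorem laplacian_norm_sq_smul (hU : IsOpen U) (hf : ContDiffOn ℝ (2 : ℕ) f U) :
    EqOn (Δ fun x => ‖x‖ ^ 2 • f x) (fun x => ‖x‖ ^ 2 • Δ f x + (4 : ℝ) • euler f x +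
      (2 * Fintype.card ι : ℝ) • f x) U := by
  intro x hx
  have hc (j : ι) : ContDiffOn ℝ (2 : ℕ) (fun x => x j • f x) U := hf.coord_smul j
  have hd : DifferentiableAt ℝ f x := ContDiffOn.differentiableAt_of_isOpen (k := 1) hU hf hx
  simp only [norm_sq_smul_eq_sum]
  rw [laplacian_sum _ hU (fun j _ => (hc j).coord_smul j) hx]
  beta_reduce
  have h1 (j : ι) : Δ (fun x => x j • x j • f x) x =
      x j • x j • Δ f x + (4 : ℝ) • (x j • pderivAt j f x) + (2 : ℝ) • f x := by
    rw [laplacian_coord_smul hU (hc j) j hx]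
    beta_reduce
    rw [laplacian_coord_smul hU hf j hx, pderivAt_coord_smul j j hd]
    simp only [if_true]
    module
  rw [Finset.sum_congr rfl fun j _ => h1 j]
  simp only [Finset.sum_add_distrib, euler, Finset.smul_sum, Finset.sum_const, Finset.card_univ]
  module

theorem laplacian_iterate_euler (hU : IsOpen U) (hf : ContDiffOn ℝ (2 * m + 1 : ℕ) f U) :
    EqOn (Δ^[m] (euler f)) (fun x => euler (Δ^[m] f) x + (2 * m : ℝ) • Δ^[m] f x) U := by
  induction m generalizing f with
  | zero => intro x _; simp
  | succ m ih =>
    intro x hx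
    have hL : ContDiffOn ℝ (2 * m + 1 : ℕ) (Δ f) U := ContDiffOn.laplacian hU hf
    rw [Function.iterate_succ_apply,
      laplacian_iterate_congr hU m (laplacian_euler hU (hf.of_nat_le (by omega))) hx,
      laplacian_iterate_add hU (hL.euler hU)
        ((hL.of_nat_le (by omega : 2 * m ≤ _)).const_smul (2 : ℝ)) hx]
    beta_reduce
    rw [ih hL hx, laplacian_iterate_const_smul 2 hU (hL.of_nat_le (by omega)) hx]
    simp only [Function.iterate_succ_apply, Nat.cast_succ]
    module

theorem ContDiffOn.norm_sq_smul (hf : ContDiffOn ℝ k f U) :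
    ContDiffOn ℝ k (fun x => ‖x‖ ^ 2 • f x) U :=
  ((contDiff_norm_sq ℝ).contDiffOn).smul hf

/-- Induction with [Δ, ‖x‖²] = 4E + 2N and Δ^m E = EΔ^m + 2mΔ^m. Taking Δf as the function
multiplied by ‖x‖² avoids the exponent m - 1 on the right, and is the form needed for the Kelvin
transform. -/
theorem laplacian_iterate_norm_sq_smul_laplacian (hU : IsOpen U)
    (hf : ContDiffOn ℝ (2 * m + 2 : ℕ) f U) :
    EqOn (Δ^[m] fun x => ‖x‖ ^ 2 • Δ f x) (fun x => ‖x‖ ^ 2 • Δ^[m + 1] f x +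
      (4 * m : ℝ) • euler (Δ^[m] f) x +
      (2 * m * (Fintype.card ι + 2 * m - 2) : ℝ) • Δ^[m] f x) U := by
  induction m generalizing f with
  | zero => intro x _; simp
  | succ m ih =>
    intro x hx
    have hL : ContDiffOn ℝ (2 * m + 2 : ℕ) (Δ f) U := ContDiffOn.laplacian hU hf
    have hLL : ContDiffOn ℝ (2 * m : ℕ) (Δ (Δ f)) U := ContDiffOn.laplacian hU hL
    have h1 : ContDiffOn ℝ (2 * m : ℕ) (fun x => (4 : ℝ) • euler (Δ f) x) U :=
      (ContDiffOn.euler hU (hL.of_nat_le (by omega))).const_smul (4 : ℝ)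
    have h2 : ContDiffOn ℝ (2 * m : ℕ) (fun x => (2 * Fintype.card ι : ℝ) • Δ f x) U :=
      (hL.of_nat_le (by omega)).const_smul _
    rw [Function.iterate_succ_apply,
      laplacian_iterate_congr hU m (laplacian_norm_sq_smul hU (hL.of_nat_le (by omega))) hx,
      laplacian_iterate_add hU (hLL.norm_sq_smul.add h1) h2 hx]
    beta_reduce
    rw [laplacian_iterate_add hU hLL.norm_sq_smul h1 hx]
    beta_reduce
    rw [ih hL hx, laplacian_iterate_const_smul _ hU
        (ContDiffOn.euler hU (hL.of_nat_le (by omega : 2 * m + 1 ≤ _))) hx,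
      laplacian_iterate_const_smul _ hU (hL.of_nat_le (by omega : 2 * m ≤ _)) hx]
    beta_reduce
    rw [laplacian_iterate_euler hU (hL.of_nat_le (by omega)) hx]
    simp only [Function.iterate_succ_apply, Nat.cast_succ]
    module

end PartialDerivatives

/-! ### The Kelvin transform and its commutation with powers of the Laplacian. -/

section Kelvin

open Laplacian Set

variable {ι : Type*} [Fintype ι] [DecidableEq ι]
  {G : Type*} [NormedAddCommGroup G] [NormedSpace ℝ G]

/-- The inversion `x ↦ x / ‖x‖²` in the unit sphere. -/
noncomputable def sphereInv (x : EuclideanSpace ℝ ι) : EuclideanSpace ℝ ι := ‖x‖ ^ (-2 : ℤ) • x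

/-- The Kelvin transform of weight `s`. -/
noncomputable def kelvin (s : ℤ) (h : EuclideanSpace ℝ ι → G) : EuclideanSpace ℝ ι → G :=
  fun x => ‖x‖ ^ s • h (sphereInv x)

/-- The set on which the Kelvin transform of a function on `U` is defined. -/
def kelvinDomain (U : Set (EuclideanSpace ℝ ι)) : Set (EuclideanSpace ℝ ι) :=
  {x | x ≠ 0 ∧ sphereInv x ∈ U}

/-- The generator of the special conformal transformations: the conjugate of `∂ⱼ` by `kelvin s`. -/
noncomputable def conformalDeriv (s : ℤ) (j : ι) (h : EuclideanSpace ℝ ι → G) :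
    EuclideanSpace ℝ ι → G :=
  fun w => ‖w‖ ^ 2 • pderivAt j h w - (2 : ℝ) • w j • euler h w + (s : ℝ) • w j • h w

variable {U : Set (EuclideanSpace ℝ ι)} {f h : EuclideanSpace ℝ ι → G} {k m : ℕ}

theorem norm_sphereInv (x : EuclideanSpace ℝ ι) : ‖sphereInv x‖ = ‖x‖⁻¹ := by
  rcases eq_or_ne x 0 with rfl | hx
  · simp [sphereInv]
  · have : ‖x‖ ≠ 0 := norm_ne_zero_iff.mpr hx
    rw [sphereInv, norm_smul, norm_zpow, norm_norm, ← zpow_add_one₀ this]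
    norm_num

theorem contDiffAt_norm_zpow (s : ℤ) {x : EuclideanSpace ℝ ι} (hx : x ≠ 0) :
    ContDiffAt ℝ k (fun y : EuclideanSpace ℝ ι => ‖y‖ ^ s) x := by
  have h := contDiffAt_norm (n := k) ℝ hx
  have h0 : ‖x‖ ≠ 0 := norm_ne_zero_iff.mpr hx
  cases s with
  | ofNat a => simpa using h.pow a
  | negSucc a =>
    simp only [zpow_negSucc]
    exact (h.pow (a + 1)).inv (pow_ne_zero _ h0)

theorem contDiffAt_sphereInv {x : EuclideanSpace ℝ ι} (hx : x ≠ 0) :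
    ContDiffAt ℝ k (sphereInv : EuclideanSpace ℝ ι → EuclideanSpace ℝ ι) x :=
  (contDiffAt_norm_zpow (-2) hx).smul contDiffAt_id

theorem isOpen_kelvinDomain (hU : IsOpen U) : IsOpen (kelvinDomain U) := by
  have h : ContinuousOn (sphereInv : EuclideanSpace ℝ ι → EuclideanSpace ℝ ι) {0}ᶜ := fun x hx =>
    (contDiffAt_sphereInv (k := 0) hx).continuousAt.continuousWithinAt
  exact h.isOpen_inter_preimage isOpen_compl_singleton hU

theorem ContDiffOn.kelvin (hf : ContDiffOn ℝ k f U) (hU : IsOpen U) (s : ℤ) :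
    ContDiffOn ℝ k (kelvin s f) (kelvinDomain U) := fun x hx =>
  ((contDiffAt_norm_zpow s hx.1).smul
    ((hf.contDiffAt (hU.mem_nhds hx.2)).comp x (contDiffAt_sphereInv hx.1))).contDiffWithinAt

/-- Since ‖x*‖ = ‖x‖⁻¹, a factor ‖w‖² inside the transform is worth a drop of 2 in the weight. -/
theorem kelvin_norm_sq_smul (s : ℤ) (h : EuclideanSpace ℝ ι → G) :
    EqOn (kelvin (s + 2) fun w => ‖w‖ ^ 2 • h w) (kelvin s h) (kelvinDomain U) := fun x hx => by
  have h0 : ‖x‖ ≠ 0 := norm_ne_zero_iff.mpr hx.1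
  rw [kelvin, kelvin, norm_sphereInv, smul_smul, zpow_add₀ h0]
  congr 1
  have : ‖x‖ ^ (2 : ℤ) = ‖x‖ ^ 2 := by norm_cast
  rw [this]
  field_simp

/-- Expressed through w = x*, so that the derivative of a Kelvin transform is visibly again a Kelvin
transform of the same weight. -/
theorem pderivAt_norm_zpow (s : ℤ) (j : ι) {x : EuclideanSpace ℝ ι} (hx : x ≠ 0) :
    pderivAt j (fun y : EuclideanSpace ℝ ι => ‖y‖ ^ s) x = s * sphereInv x j * ‖x‖ ^ s := by
  have h0 : ‖x‖ ≠ 0 := norm_ne_zero_iff.mpr hx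
  have hn : DifferentiableAt ℝ (fun y : EuclideanSpace ℝ ι => ‖y‖) x :=
    (contDiffAt_norm (n := 1) ℝ hx).differentiableAt (by simp)
  -- The derivative of the norm comes from differentiating ‖y‖² in two ways, through the inner
  -- product and as a square.
  have h1 : ‖x‖ * pderivAt j (fun y : EuclideanSpace ℝ ι => ‖y‖) x = x j := by
    have h2 := congrArg (fun L => L (EuclideanSpace.single j (1 : ℝ)))
      ((hasStrictFDerivAt_norm_sq x).hasFDerivAt.unique (hn.hasFDerivAt.pow 2))
    simp [EuclideanSpace.inner_single_right] at h2
    rw [pderivAt]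
    linarith
  have h3 := (hasDerivAt_zpow s ‖x‖ (Or.inl h0)).comp_hasFDerivAt x hn.hasFDerivAt
  have h4 : pderivAt j (fun y : EuclideanSpace ℝ ι => ‖y‖ ^ s) x =
      s * ‖x‖ ^ (s - 1) * pderivAt j (fun y : EuclideanSpace ℝ ι => ‖y‖) x := by
    have h5 : (fun y : EuclideanSpace ℝ ι => ‖y‖ ^ s) =
      (fun t : ℝ => t ^ s) ∘ fun y : EuclideanSpace ℝ ι => ‖y‖ := rfl
    rw [pderivAt, h5, h3.fderiv]
    rfl
  rw [h4]
  simp only [sphereInv, PiLp.smul_apply, smul_eq_mul]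
  rw [← h1, zpow_sub_one₀ h0]
  have : ‖x‖ ^ (-2 : ℤ) = (‖x‖ ^ 2)⁻¹ := by rw [zpow_neg]; norm_cast
  rw [this]
  field_simp

/-- With w = x*, the derivative of the inversion at x is v ↦ ‖w‖² v - 2⟨w, v⟩ w. The second term
produces the Euler operator, and differentiating ‖x‖^s produces s w_j h. -/
theorem pderivAt_kelvin (hU : IsOpen U) (hh : ContDiffOn ℝ (1 : ℕ) h U) (s : ℤ) (j : ι) :
    EqOn (pderivAt j (kelvin s h)) (kelvin s (conformalDeriv s j h)) (kelvinDomain U) := by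
  intro x hx
  have h0 : ‖x‖ ≠ 0 := norm_ne_zero_iff.mpr hx.1
  have hd : DifferentiableAt ℝ h (sphereInv x) :=
    ContDiffOn.differentiableAt_of_isOpen (k := 0) hU hh hx.2
  have hz (a : ℤ) : DifferentiableAt ℝ (fun y : EuclideanSpace ℝ ι => ‖y‖ ^ a) x :=
    (contDiffAt_norm_zpow (k := 1) a hx.1).differentiableAt (by simp)
  have hi : DifferentiableAt ℝ (sphereInv : EuclideanSpace ℝ ι → EuclideanSpace ℝ ι) x :=
    (contDiffAt_sphereInv (k := 1) hx.1).differentiableAt (by simp)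
  have hw : ‖x‖ ^ (-2 : ℤ) = ‖sphereInv x‖ ^ 2 := by
    rw [norm_sphereInv, zpow_neg, inv_pow]
    norm_cast
  have hi' : fderiv ℝ sphereInv x (EuclideanSpace.single j 1) =
      ‖sphereInv x‖ ^ 2 • EuclideanSpace.single j (1 : ℝ) -
        (2 * sphereInv x j) • sphereInv x := by
    have h1 := pderivAt_smul j (f := fun y : EuclideanSpace ℝ ι => y) (hz (-2)) differentiableAt_id
    rw [pderivAt_norm_zpow _ _ hx.1, pderivAt, pderivAt] at h1
    change fderiv ℝ sphereInv x (EuclideanSpace.single j 1) = _ at h1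
    rw [h1, ← hw, mul_smul, mul_smul]
    change ((-2 : ℤ) : ℝ) • sphereInv x j • sphereInv x + ‖x‖ ^ (-2 : ℤ) •
      fderiv ℝ (fun y : EuclideanSpace ℝ ι => y) x (EuclideanSpace.single j 1) = _
    rw [fderiv_fun_id]
    push_cast
    change _ + ‖x‖ ^ (-2 : ℤ) • EuclideanSpace.single j (1 : ℝ) = _
    module
  have hc : pderivAt j (fun y => h (sphereInv y)) x =
      ‖sphereInv x‖ ^ 2 • pderivAt j h (sphereInv x) -
        (2 * sphereInv x j) • euler h (sphereInv x) := by
    have h1 : (fun y => h (sphereInv y)) = h ∘ sphereInv := rfl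
    rw [pderivAt, h1, fderiv_comp x hd hi, ContinuousLinearMap.comp_apply, hi', map_sub, map_smul,
      map_smul, fderiv_eq_sum_pderivAt h _ (sphereInv x)]
    rfl
  have hk : kelvin s h = fun y => ‖y‖ ^ s • h (sphereInv y) := rfl
  have hhi : DifferentiableAt ℝ (fun y => h (sphereInv y)) x := hd.comp x hi
  rw [hk, pderivAt_smul j (hz s) hhi, pderivAt_norm_zpow _ _ hx.1, hc, kelvin,
    conformalDeriv]
  module

theorem ContDiffOn.conformalDeriv (hU : IsOpen U) (hh : ContDiffOn ℝ (k + 1 : ℕ) h U) (s : ℤ)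
    (j : ι) : ContDiffOn ℝ k (conformalDeriv s j h) U := by
  refine ContDiffOn.add (ContDiffOn.sub (hh.pderivAt hU j).norm_sq_smul ?_) ?_
  · exact ((hh.euler hU).coord_smul j).const_smul (2 : ℝ)
  · exact ((hh.of_nat_le (by omega)).coord_smul j).const_smul (s : ℝ)

theorem pderivAt_euler (hU : IsOpen U) (hh : ContDiffOn ℝ (2 : ℕ) h U) (j : ι) :
    EqOn (pderivAt j (euler h)) (fun x => pderivAt j h x + euler (pderivAt j h) x) U := by
  intro x hx
  have hd (i : ι) : DifferentiableAt ℝ (pderivAt i h) x :=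
    ContDiffOn.differentiableAt_of_isOpen (k := 0) hU (ContDiffOn.pderivAt (k := 1) hU hh i) hx
  unfold euler
  rw [pderivAt_sum _ _ fun i _ => (hd i).coord_smul i]
  rw [Finset.sum_congr rfl fun i _ => pderivAt_coord_smul j i (hd i), Finset.sum_add_distrib]
  simp [pderivAt_comm hU hh j _ hx]

theorem pderivAt_norm_sq_smul (j : ι) {x : EuclideanSpace ℝ ι} (hf : DifferentiableAt ℝ f x) :
    pderivAt j (fun y => ‖y‖ ^ 2 • f y) x = (2 * x j) • f x + ‖x‖ ^ 2 • pderivAt j f x := by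
  simp only [norm_sq_smul_eq_sum]
  rw [pderivAt_sum _ _ fun i _ => (hf.coord_smul i).coord_smul i]
  rw [Finset.sum_congr rfl fun i _ => pderivAt_coord_smul j i (hf.coord_smul i),
    Finset.sum_congr rfl fun i _ => by rw [pderivAt_coord_smul j i hf]]
  simp only [smul_add, Finset.sum_add_distrib, smul_ite, smul_zero, Finset.sum_ite_eq',
    Finset.mem_univ, if_true]
  module

theorem euler_add {x : EuclideanSpace ℝ ι} (hf : DifferentiableAt ℝ f x)
    (hh : DifferentiableAt ℝ h x) : euler (fun y => f y + h y) x = euler f x + euler h x := by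
  simp [euler, pderivAt_add _ hf hh, Finset.sum_add_distrib]

theorem euler_sub {x : EuclideanSpace ℝ ι} (hf : DifferentiableAt ℝ f x)
    (hh : DifferentiableAt ℝ h x) : euler (fun y => f y - h y) x = euler f x - euler h x := by
  simp [euler, pderivAt_sub _ hf hh, smul_sub]

theorem euler_const_smul (c : ℝ) (f : EuclideanSpace ℝ ι → G) (x : EuclideanSpace ℝ ι) :
    euler (fun y => c • f y) x = c • euler f x := by
  simp [euler, pderivAt_const_smul, Finset.smul_sum, smul_comm c]

theorem euler_norm_sq_smul {x : EuclideanSpace ℝ ι} (hf : DifferentiableAt ℝ f x) :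
    euler (fun y => ‖y‖ ^ 2 • f y) x = (2 * ‖x‖ ^ 2) • f x + ‖x‖ ^ 2 • euler f x := by
  rw [mul_smul, norm_sq_smul_eq_sum x (f x)]
  simp only [euler, pderivAt_norm_sq_smul _ hf, smul_add, Finset.sum_add_distrib, Finset.smul_sum]
  congr 1
  · exact Finset.sum_congr rfl fun i _ => by module
  · exact Finset.sum_congr rfl fun i _ => smul_comm _ _ _

theorem euler_coord_smul (j : ι) {x : EuclideanSpace ℝ ι} (hf : DifferentiableAt ℝ f x) :
    euler (fun y => y j • f y) x = x j • f x + x j • euler f x := by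
  simp [euler, pderivAt_coord_smul _ _ hf, Finset.sum_add_distrib, Finset.smul_sum, smul_comm (x j)]

/-- Conjugated by the Kelvin transform, the Laplacian becomes the sum of squares of the operators
`conformalDeriv s j`. Its E² terms cancel and a common factor ‖w‖² comes out, which later lowers the
weight by 2. -/
theorem sum_conformalDeriv_conformalDeriv (hU : IsOpen U) (hh : ContDiffOn ℝ (2 : ℕ) h U)
    (s : ℤ) {w : EuclideanSpace ℝ ι} (hw : w ∈ U) :
    ∑ j, conformalDeriv s j (conformalDeriv s j h) w = ‖w‖ ^ 2 • (‖w‖ ^ 2 • Δ h w -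
      (2 * Fintype.card ι + 2 * s - 4 : ℝ) • euler h w +
      (s * (s + Fintype.card ι - 2) : ℝ) • h w) := by
  have hd : DifferentiableAt ℝ h w := ContDiffOn.differentiableAt_of_isOpen (k := 1) hU hh hw
  have hp (j : ι) : DifferentiableAt ℝ (pderivAt j h) w :=
    ContDiffOn.differentiableAt_of_isOpen (k := 0) hU (ContDiffOn.pderivAt (k := 1) hU hh j) hw
  have he : DifferentiableAt ℝ (euler h) w :=
    ContDiffOn.differentiableAt_of_isOpen (k := 0) hU (ContDiffOn.euler (k := 1) hU hh) hw
  have hn (j : ι) : DifferentiableAt ℝ (fun w => ‖w‖ ^ 2 • pderivAt j h w) w :=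
    (contDiff_norm_sq ℝ).contDiffAt.differentiableAt (n := 1) (by simp) |>.smul (hp j)
  have h1 (j : ι) : DifferentiableAt ℝ (fun w => (2 : ℝ) • w j • euler h w) w :=
    (he.coord_smul j).const_smul (2 : ℝ)
  have h2 (j : ι) : DifferentiableAt ℝ (fun w => (s : ℝ) • w j • h w) w :=
    (hd.coord_smul j).const_smul (s : ℝ)
  have h3 (j : ι) : DifferentiableAt ℝ
      (fun w => ‖w‖ ^ 2 • pderivAt j h w - (2 : ℝ) • w j • euler h w) w := (hn j).sub (h1 j)
  -- The terms are grouped by their dependence on j, so that summation yields only Δh, Eh, E²h and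
  -- multiples of h.
  have hP (j : ι) : conformalDeriv s j (conformalDeriv s j h) w =
      (‖w‖ ^ 2 * ‖w‖ ^ 2) • pderivAt j (pderivAt j h) w +
      ((2 * s - 4) * ‖w‖ ^ 2 : ℝ) • (w j • pderivAt j h w) -
      (4 * ‖w‖ ^ 2) • (w j • euler (pderivAt j h) w) +
      w j • w j • ((4 : ℝ) • euler (euler h) w + (4 - 4 * s : ℝ) • euler h w +
        (s * s - 2 * s : ℝ) • h w) +
      ‖w‖ ^ 2 • ((s : ℝ) • h w - (2 : ℝ) • euler h w) := by
    unfold conformalDeriv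
    rw [pderivAt_add j (h3 j) (h2 j), pderivAt_sub j (hn j) (h1 j), pderivAt_const_smul,
      pderivAt_const_smul, pderivAt_norm_sq_smul j (hp j), pderivAt_coord_smul j j he,
      pderivAt_coord_smul j j hd, pderivAt_euler hU hh j hw, euler_add (h3 j) (h2 j),
      euler_sub (hn j) (h1 j), euler_const_smul, euler_const_smul, euler_norm_sq_smul (hp j),
      euler_coord_smul j he, euler_coord_smul j hd]
    simp only [if_true]
    module
  -- This is ∂_j E = ∂_j + E∂_j, multiplied by w_j and summed.
  have hE : ∑ j, w j • euler (pderivAt j h) w = euler (euler h) w - euler h w := by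
    rw [eq_sub_iff_add_eq']
    conv_rhs => rw [euler]
    conv_lhs => enter [1]; rw [euler]
    rw [← Finset.sum_add_distrib]
    exact Finset.sum_congr rfl fun j _ => by rw [pderivAt_euler hU hh j hw, smul_add]
  have hE' : ∑ j, w j • pderivAt j h w = euler h w := rfl
  have hL := laplacian_eqOn hU hh hw
  beta_reduce at hL
  rw [Finset.sum_congr rfl fun j _ => hP j]
  simp only [Finset.sum_add_distrib, Finset.sum_sub_distrib, ← Finset.smul_sum, hE, hE', ← hL,
    ← norm_sq_smul_eq_sum, Finset.sum_const, Finset.card_univ]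
  module

theorem laplacian_kelvin (hU : IsOpen U) (hh : ContDiffOn ℝ (2 : ℕ) h U) (s : ℤ) :
    EqOn (Δ (kelvin s h)) (kelvin (s - 2) fun w => ‖w‖ ^ 2 • Δ h w -
      (2 * Fintype.card ι + 2 * s - 4 : ℝ) • euler h w +
      (s * (s + Fintype.card ι - 2) : ℝ) • h w) (kelvinDomain U) := by
  intro x hx
  have hV := isOpen_kelvinDomain hU
  have hs : s = s - 2 + 2 := by ring
  rw [laplacian_eqOn hV (hh.kelvin hU s) hx, ← kelvin_norm_sq_smul (s - 2) _ hx, ← hs, kelvin,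
    ← sum_conformalDeriv_conformalDeriv hU hh s hx.2, Finset.smul_sum]
  refine Finset.sum_congr rfl fun j _ => ?_
  rw [pderivAt_congr hV (pderivAt_kelvin hU (hh.of_nat_le (by omega)) s j) j hx,
    pderivAt_kelvin hU (ContDiffOn.conformalDeriv (k := 1) hU hh s j) s j hx, kelvin]

/-- Induction, peeling off the innermost Laplacian: it lowers the weight from 2(m + 1) - N to 2m -
N, exactly the weight of the induction hypothesis. Its lower-order terms disappear only after the
remaining Δ^m has been applied. -/
theorem laplacian_iterate_kelvin (hU : IsOpen U) (hh : ContDiffOn ℝ (2 * m : ℕ) h U) :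
    EqOn (Δ^[m] (kelvin (2 * m - Fintype.card ι) h))
      (kelvin (-2 * m - Fintype.card ι) (Δ^[m] h)) (kelvinDomain U) := by
  induction m generalizing h with
  | zero => intro x _; simp
  | succ m ih =>
    intro x hx
    have hL : ContDiffOn ℝ (2 * m : ℕ) (Δ h) U := ContDiffOn.laplacian hU hh
    have he : ContDiffOn ℝ (2 * m : ℕ) (fun w => (-(4 * m) : ℝ) • euler h w) U :=
      (ContDiffOn.euler hU (hh.of_nat_le (by omega : 2 * m + 1 ≤ _))).const_smul _
    have hc : ContDiffOn ℝ (2 * m : ℕ)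
        (fun w => (2 * m * (2 * m + 2 - Fintype.card ι) : ℝ) • h w) U :=
      (hh.of_nat_le (by omega)).const_smul _
    -- For s = 2(m + 1) - N the coefficients of `laplacian_kelvin` are 2N + 2s - 4 = 4m and s(s + N
    -- - 2) = 2m(2m + 2 - N).
    have h1 : EqOn (Δ (kelvin (2 * (m + 1 : ℕ) - Fintype.card ι) h))
        (kelvin (2 * m - Fintype.card ι) fun w => ‖w‖ ^ 2 • Δ h w +
          (-(4 * m) : ℝ) • euler h w + (2 * m * (2 * m + 2 - Fintype.card ι) : ℝ) • h w)
        (kelvinDomain U) := fun y hy => by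
      rw [laplacian_kelvin hU (hh.of_nat_le (by omega)) _ hy]
      have hs : (2 * (m + 1 : ℕ) - Fintype.card ι - 2 : ℤ) = 2 * m - Fintype.card ι := by
        push_cast; ring
      rw [hs, kelvin, kelvin]
      push_cast
      module
    rw [Function.iterate_succ_apply, laplacian_iterate_congr (isOpen_kelvinDomain hU) m h1 hx,
      ih ((hL.norm_sq_smul.add he).add hc) hx]
    have hs : (-2 * (m + 1 : ℕ) - Fintype.card ι : ℤ) + 2 = -2 * m - Fintype.card ι := by
      push_cast; ring
    rw [← kelvin_norm_sq_smul (-2 * (m + 1 : ℕ) - Fintype.card ι) _ hx, hs, kelvin, kelvin,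
      laplacian_iterate_add hU (hL.norm_sq_smul.add he) hc hx.2]
    beta_reduce
    rw [laplacian_iterate_add hU hL.norm_sq_smul he hx.2]
    beta_reduce
    rw [laplacian_iterate_norm_sq_smul_laplacian hU (hh.of_nat_le (by omega)) hx.2,
      laplacian_iterate_const_smul _ hU
        (ContDiffOn.euler hU (hh.of_nat_le (by omega : 2 * m + 1 ≤ _))) hx.2,
      laplacian_iterate_const_smul _ hU (hh.of_nat_le (by omega : 2 * m ≤ _)) hx.2]
    beta_reduce
    rw [laplacian_iterate_euler hU (hh.of_nat_le (by omega)) hx.2]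
    -- The terms EΔ^m h cancel, and so do those in Δ^m h: 2m(N + 2m - 2) - 8m² + 2m(2m + 2 - N) = 0.
    module

end Kelvin

/-! ### Dirac operators with Clifford coefficients and their behaviour under inversion. -/

namespace Cl

open Laplacian Set

variable {n : ℕ} {U : Set (EuclideanSpace ℝ (Fin (n + 1)))}
  {f g : EuclideanSpace ℝ (Fin (n + 1)) → Cl n} {k m : ℕ}

instance finiteDimensional (n : ℕ) : FiniteDimensional ℝ (Cl n) :=
  (bladeBasis n).finiteDimensional_of_finite

/-- Left multiplication by a Clifford number, as a continuous linear map. -/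
noncomputable def mulLeftL (a : Cl n) : Cl n →L[ℝ] Cl n :=
  (LinearMap.mulLeft ℝ a).toContinuousLinearMap

theorem mulLeftL_apply (a b : Cl n) : mulLeftL a b = a * b := rfl

theorem contDiffOn_const_mul (a : Cl n) (hf : ContDiffOn ℝ k f U) :
    ContDiffOn ℝ k (fun x => a * f x) U :=
  (mulLeftL a).contDiff.comp_contDiffOn hf

theorem differentiableAt_const_mul (a : Cl n) {x : EuclideanSpace ℝ (Fin (n + 1))}
    (hf : DifferentiableAt ℝ f x) : DifferentiableAt ℝ (fun x => a * f x) x :=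
  (mulLeftL a).differentiableAt.comp x hf

theorem pderivAt_const_mul (a : Cl n) (i : Fin (n + 1)) {x : EuclideanSpace ℝ (Fin (n + 1))}
    (hf : DifferentiableAt ℝ f x) : pderivAt i (fun x => a * f x) x = a * pderivAt i f x :=
  pderivAt_comp_clm (mulLeftL a) i hf

/-- The first-order operator `∑ⱼ qⱼ ∂ⱼ`. -/
noncomputable def diracWith (q : Fin (n + 1) → Cl n)
    (f : EuclideanSpace ℝ (Fin (n + 1)) → Cl n) : EuclideanSpace ℝ (Fin (n + 1)) → Cl n :=
  fun x => ∑ j, q j * pderivAt j f x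

/-- The paravector units `1, e₁, …, eₙ`. -/
noncomputable def unit (j : Fin (n + 1)) : Cl n := para (EuclideanSpace.single j 1)

theorem para_eq_sum (x : EuclideanSpace ℝ (Fin (n + 1))) :
    (para x : Cl n) = ∑ j, x j • unit j := by
  conv_lhs => rw [← (EuclideanSpace.basisFun (Fin (n + 1)) ℝ).sum_repr x]
  simp [unit]

theorem star_smul_real (r : ℝ) (a : Cl n) : star (r • a) = r • star a := by
  rw [CliffordAlgebra.star_def, CliffordAlgebra.star_def, map_smul, map_smul]

theorem star_para_eq_sum (x : EuclideanSpace ℝ (Fin (n + 1))) :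
    star (para x : Cl n) = ∑ j, x j • star (unit j) := by
  rw [para_eq_sum, star_sum]
  exact Finset.sum_congr rfl fun j _ => star_smul_real _ _

theorem para_mul_star_add (x y : EuclideanSpace ℝ (Fin (n + 1))) :
    (para x : Cl n) * star (para y) + para y * star (para x) = (2 * inner ℝ x y : ℝ) • 1 := by
  have h := para_mul_star (x + y)
  rw [map_add, star_add, add_mul, mul_add, mul_add, para_mul_star, para_mul_star,
    norm_add_sq_real, map_add, map_add, ← sub_eq_zero] at h
  rw [← Algebra.algebraMap_eq_smul_one, ← sub_eq_zero, ← h]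
  abel

theorem star_para_mul_add (x y : EuclideanSpace ℝ (Fin (n + 1))) :
    star (para x : Cl n) * para y + star (para y) * para x = (2 * inner ℝ x y : ℝ) • 1 := by
  have h := star_mul_para (x + y)
  rw [map_add, star_add, add_mul, mul_add, mul_add, star_mul_para, star_mul_para,
    norm_add_sq_real, map_add, map_add, ← sub_eq_zero] at h
  rw [← Algebra.algebraMap_eq_smul_one, ← sub_eq_zero, ← h]
  abel

theorem unit_mul_star_para_add (j : Fin (n + 1)) (x : EuclideanSpace ℝ (Fin (n + 1))) :
    unit j * star (para x : Cl n) + para x * star (unit j) = (2 * x j) • 1 := by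
  rw [unit, para_mul_star_add]
  simp [EuclideanSpace.inner_single_left]

theorem unit_mul_star_unit_add (i j : Fin (n + 1)) :
    (unit i : Cl n) * star (unit j) + unit j * star (unit i) = (if i = j then 2 else 0 : ℝ) • 1 := by
  rw [unit, unit, para_mul_star_add]
  simp [EuclideanSpace.inner_single_left]

theorem star_unit_mul_unit_add (i j : Fin (n + 1)) :
    star (unit i : Cl n) * unit j + star (unit j) * unit i = (if i = j then 2 else 0 : ℝ) • 1 := by
  rw [unit, unit, star_para_mul_add]
  simp [EuclideanSpace.inner_single_left]

theorem unit_mul_star_unit_self (j : Fin (n + 1)) : (unit j : Cl n) * star (unit j) = 1 := by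
  rw [unit, para_mul_star]
  simp

theorem _root_.ContDiffOn.diracWith (hU : IsOpen U) (q : Fin (n + 1) → Cl n)
    (hf : ContDiffOn ℝ (k + 1 : ℕ) f U) : ContDiffOn ℝ k (diracWith q f) U :=
  ContDiffOn.sum fun j _ => contDiffOn_const_mul (q j) (hf.pderivAt hU j)

theorem diracWith_congr (hU : IsOpen U) (q : Fin (n + 1) → Cl n) (h : EqOn f g U) :
    EqOn (diracWith q f) (diracWith q g) U := fun x hx =>
  Finset.sum_congr rfl fun j _ => by rw [pderivAt_congr hU h j hx]

theorem laplacian_diracWith (hU : IsOpen U) (q : Fin (n + 1) → Cl n)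
    (hf : ContDiffOn ℝ (3 : ℕ) f U) : EqOn (Δ (diracWith q f)) (diracWith q (Δ f)) U := by
  intro x hx
  have hp (j) : ContDiffOn ℝ (2 : ℕ) (pderivAt j f) U := ContDiffOn.pderivAt (k := 2) hU hf j
  unfold diracWith
  rw [laplacian_sum _ hU (fun j _ => contDiffOn_const_mul (q j) (hp j)) hx]
  refine Finset.sum_congr rfl fun j _ => ?_
  exact (laplacian_comp_clm (mulLeftL (q j)) hU (hp j) hx).trans
    (by beta_reduce; rw [mulLeftL_apply, laplacian_pderivAt hU hf j hx])

theorem laplacian_iterate_diracWith (hU : IsOpen U) (q : Fin (n + 1) → Cl n)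
    (hf : ContDiffOn ℝ (2 * m + 1 : ℕ) f U) :
    EqOn (Δ^[m] (diracWith q f)) (diracWith q (Δ^[m] f)) U := by
  induction m generalizing f with
  | zero => exact fun x _ => rfl
  | succ m ih =>
    exact (laplacian_iterate_congr hU m (laplacian_diracWith hU q (hf.of_nat_le (by omega)))).trans
      (ih (ContDiffOn.laplacian hU hf))

/-- If the units satisfy the Clifford relations `pᵢ qⱼ + pⱼ qᵢ = 2δᵢⱼ`, the product of the
first-order operators is the Laplacian. -/
theorem diracWith_diracWith (hU : IsOpen U) {p q : Fin (n + 1) → Cl n}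
    (h : ∀ i j, p i * q j + p j * q i = (if i = j then 2 else 0 : ℝ) • 1)
    (hf : ContDiffOn ℝ (2 : ℕ) f U) : EqOn (diracWith p (diracWith q f)) (Δ f) U := by
  intro x hx
  have hd (j : Fin (n + 1)) : DifferentiableAt ℝ (pderivAt j f) x :=
    ContDiffOn.differentiableAt_of_isOpen (k := 0) hU (ContDiffOn.pderivAt (k := 1) hU hf j) hx
  have h1 : diracWith p (diracWith q f) x =
      ∑ i, ∑ j, p i * q j * pderivAt i (pderivAt j f) x := by
    refine Finset.sum_congr rfl fun i _ => ?_
    unfold diracWith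
    rw [pderivAt_sum _ _ fun j _ => differentiableAt_const_mul (q j) (hd j), Finset.mul_sum]
    exact Finset.sum_congr rfl fun j _ => by rw [pderivAt_const_mul _ _ (hd j), mul_assoc]
  -- Swapping the indices and using symmetry of second derivatives gives a second expression; its
  -- sum with `h1` contains only the symmetrised products p_i q_j + p_j q_i.
  have h2 : diracWith p (diracWith q f) x =
      ∑ i, ∑ j, p j * q i * pderivAt i (pderivAt j f) x := by
    rw [h1, Finset.sum_comm]
    exact Finset.sum_congr rfl fun i _ => Finset.sum_congr rfl fun j _ => by
      rw [pderivAt_comm hU hf i j hx]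
  have h3 : (2 : ℝ) • diracWith p (diracWith q f) x = (2 : ℝ) • Δ f x := by
    rw [two_smul]
    nth_rw 1 [h1]
    rw [h2, ← Finset.sum_add_distrib, laplacian_eqOn hU hf hx, Finset.smul_sum]
    refine Finset.sum_congr rfl fun i _ => ?_
    rw [← Finset.sum_add_distrib]
    simp [← add_mul, h, ite_smul, ite_mul]
  exact smul_right_injective _ (two_ne_zero (α := ℝ)) h3

theorem pderivAt_star_para_mul (j : Fin (n + 1)) {x : EuclideanSpace ℝ (Fin (n + 1))}
    (hf : DifferentiableAt ℝ f x) : pderivAt j (fun y => star (para y) * f y) x =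
      star (unit j) * f x + star (para x) * pderivAt j f x := by
  simp only [star_para_eq_sum, Finset.sum_mul, smul_mul_assoc]
  rw [pderivAt_sum _ _ fun i _ => (differentiableAt_const_mul _ hf).coord_smul i]
  simp only [pderivAt_coord_smul j _ (differentiableAt_const_mul _ hf),
    pderivAt_const_mul _ j hf, Finset.sum_add_distrib]
  simp

theorem contDiffOn_star_para_mul (hf : ContDiffOn ℝ k f U) :
    ContDiffOn ℝ k (fun y => star (para y) * f y) U := by
  simp only [star_para_eq_sum, Finset.sum_mul, smul_mul_assoc]
  exact ContDiffOn.sum fun i _ => (contDiffOn_const_mul _ hf).coord_smul i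

theorem contDiffOn_para_mul (hf : ContDiffOn ℝ k f U) :
    ContDiffOn ℝ k (fun y => para y * f y) U := by
  simp only [para_eq_sum, Finset.sum_mul, smul_mul_assoc]
  exact ContDiffOn.sum fun i _ => (contDiffOn_const_mul _ hf).coord_smul i

theorem euler_star_para_mul {x : EuclideanSpace ℝ (Fin (n + 1))} (hf : DifferentiableAt ℝ f x) :
    euler (fun y => star (para y) * f y) x = star (para x) * f x + star (para x) * euler f x := by
  simp only [euler, pderivAt_star_para_mul _ hf, smul_add, Finset.sum_add_distrib, Finset.mul_sum,
    mul_smul_comm]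
  congr 1
  rw [star_para_eq_sum, Finset.sum_mul]
  simp

/-- The relation e_j x̄ = 2x_j - x ē_j moves the variable to the left, leaving 2E and turning D into
D̄. The constant n + 1 is the sum of e_j ē_j = 1. -/
theorem dirac_star_para_mul {x : EuclideanSpace ℝ (Fin (n + 1))} (hf : DifferentiableAt ℝ f x) :
    diracWith unit (fun y => star (para y) * f y) x = (n + 1 : ℝ) • f x + (2 : ℝ) • euler f x -
      para x * diracWith (fun j => star (unit j)) f x := by
  have h (j : Fin (n + 1)) : unit j * (star (unit j) * f x + star (para x) * pderivAt j f x) =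
      f x + (2 : ℝ) • (x j • pderivAt j f x) - para x * (star (unit j) * pderivAt j f x) := by
    have h1 := eq_sub_of_add_eq (unit_mul_star_para_add j x)
    rw [mul_add, ← mul_assoc, ← mul_assoc, unit_mul_star_unit_self, one_mul, h1, sub_mul,
      smul_mul_assoc, one_mul, mul_smul, mul_assoc]
    abel
  simp only [diracWith, pderivAt_star_para_mul _ hf, h, Finset.sum_sub_distrib,
    Finset.sum_add_distrib, ← Finset.smul_sum, ← Finset.mul_sum, Finset.sum_const, Finset.card_univ,
    Fintype.card_fin, euler]
  congr 2
  rw [← Nat.cast_smul_eq_nsmul ℝ]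
  push_cast
  rfl

theorem laplacian_para_mul (hU : IsOpen U) (hf : ContDiffOn ℝ (2 : ℕ) f U) :
    EqOn (Δ fun x => para x * f x)
      (fun x => para x * Δ f x + (2 : ℝ) • diracWith unit f x) U := by
  intro x hx
  have hd : DifferentiableAt ℝ f x := ContDiffOn.differentiableAt_of_isOpen (k := 1) hU hf hx
  simp only [para_eq_sum, Finset.sum_mul, smul_mul_assoc]
  rw [laplacian_sum _ hU (fun j _ => (contDiffOn_const_mul _ hf).coord_smul j) hx]
  beta_reduce
  rw [Finset.sum_congr rfl fun j _ =>
    laplacian_coord_smul hU (contDiffOn_const_mul (unit j) hf) j hx]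
  rw [Finset.sum_add_distrib, diracWith, Finset.smul_sum]
  congr 1
  · exact Finset.sum_congr rfl fun j _ => congrArg _ (laplacian_comp_clm (mulLeftL _) hU hf hx)
  · exact Finset.sum_congr rfl fun j _ => by rw [pderivAt_const_mul _ _ hd]

/-- Each Laplacian crossing the variable leaves 2D, and D D̄ = Δ turns this into one more 2Δf,
whence 2m after m steps. -/
theorem laplacian_iterate_para_mul_dirac_star (hU : IsOpen U)
    (hf : ContDiffOn ℝ (2 * m + 1 : ℕ) f U) :
    EqOn (Δ^[m] fun x => para x * diracWith (fun j => star (unit j)) f x)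
      (fun x => para x * diracWith (fun j => star (unit j)) (Δ^[m] f) x +
        (2 * m : ℝ) • Δ^[m] f x) U := by
  induction m generalizing f with
  | zero => intro x _; simp
  | succ m ih =>
    intro x hx
    have hL : ContDiffOn ℝ (2 * m + 1 : ℕ) (Δ f) U := ContDiffOn.laplacian hU hf
    have h1 : EqOn (Δ fun x => para x * diracWith (fun j => star (unit j)) f x)
        (fun x => para x * diracWith (fun j => star (unit j)) (Δ f) x + (2 : ℝ) • Δ f x) U := by
      intro y hy
      rw [laplacian_para_mul hU
        ((ContDiffOn.diracWith (k := 2 * m + 2) hU _ hf).of_nat_le (by omega)) hy]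
      beta_reduce
      rw [laplacian_diracWith hU _ (hf.of_nat_le (by omega)) hy,
        diracWith_diracWith hU unit_mul_star_unit_add (hf.of_nat_le (by omega)) hy]
    rw [Function.iterate_succ_apply, laplacian_iterate_congr hU m h1 hx,
      laplacian_iterate_add hU (contDiffOn_para_mul (hL.diracWith hU _))
        ((hL.of_nat_le (by omega : 2 * m ≤ _)).const_smul (2 : ℝ)) hx]
    beta_reduce
    rw [ih hL hx, laplacian_iterate_const_smul _ hU (hL.of_nat_le (by omega)) hx]
    simp only [Function.iterate_succ_apply, Nat.cast_succ]
    module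

theorem star_para_mul_kelvin (s : ℤ) (f : EuclideanSpace ℝ (Fin (n + 1)) → Cl n) :
    EqOn (fun x => star (para x) * kelvin s f x)
      (kelvin (s + 2) fun w => star (para w) * f w) (kelvinDomain U) := by
  intro x hx
  have h0 : ‖x‖ ≠ 0 := norm_ne_zero_iff.mpr hx.1
  have h1 : (para (sphereInv x) : Cl n) = ‖x‖ ^ (-2 : ℤ) • para x := by rw [sphereInv, map_smul]
  simp only [kelvin, h1, star_smul_real, mul_smul_comm, smul_mul_assoc, smul_smul]
  rw [← zpow_add₀ h0]
  norm_num

/-- The factor x̄ is absorbed into the transform at weight s + 2, where ∂_j becomes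
`conformalDeriv`. The Euler terms then cancel against those of `dirac_star_para_mul`, and the
constants add up to (n + 1) - 2 + (s + 2) = s + n + 1. -/
theorem dirac_star_para_mul_kelvin (hU : IsOpen U) (hf : ContDiffOn ℝ (1 : ℕ) f U) (s : ℤ) :
    EqOn (diracWith unit fun x => star (para x) * kelvin s f x)
      (kelvin s fun w => (s + n + 1 : ℝ) • f w -
        para w * diracWith (fun j => star (unit j)) f w) (kelvinDomain U) := by
  intro x hx
  have hd : DifferentiableAt ℝ f (sphereInv x) :=
    ContDiffOn.differentiableAt_of_isOpen (k := 0) hU hf hx.2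
  rw [diracWith_congr (isOpen_kelvinDomain hU) _ (star_para_mul_kelvin s f) hx,
    ← kelvin_norm_sq_smul s _ hx]
  unfold diracWith
  simp only [pderivAt_kelvin hU (contDiffOn_star_para_mul hf) _ _ hx]
  simp only [kelvin, mul_smul_comm, ← Finset.smul_sum]
  congr 1
  generalize sphereInv x = w at hd
  have hn : (para w : Cl n) * star (para w) = ‖w‖ ^ 2 • 1 := by
    rw [para_mul_star, Algebra.algebraMap_eq_smul_one]
  have h2 := dirac_star_para_mul hd
  unfold diracWith at h2
  simp only [conformalDeriv, mul_add, mul_sub, mul_smul_comm, Finset.sum_add_distrib,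
    Finset.sum_sub_distrib, ← Finset.smul_sum, h2, euler_star_para_mul hd]
  have h3 (v : Cl n) : ∑ j, w j • (unit j * (star (para w) * v)) = ‖w‖ ^ 2 • v := by
    rw [← one_mul v, ← smul_mul_assoc, ← hn, one_mul, para_eq_sum w, Finset.sum_mul,
      Finset.sum_mul]
    simp only [smul_mul_assoc, mul_assoc]
  simp only [smul_add, Finset.sum_add_distrib, h3]
  push_cast
  module

/-- At weight s = 2m - (n + 1) the zeroth-order term of the Dirac formula is 2m f, and it cancels
the 2m Δ^m f created by moving Δ^m past the variable. What remains contains only D̄Δ^m f, so the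
inversion turns solutions for D̄ into solutions for D. -/
theorem dirac_laplacian_iterate_star_para_mul_kelvin (hU : IsOpen U)
    (hf : ContDiffOn ℝ (2 * m + 1 : ℕ) f U) :
    EqOn (diracWith unit (Δ^[m] fun x => star (para x) * kelvin (2 * m - (n + 1 : ℕ)) f x))
      (kelvin (-2 * m - (n + 1 : ℕ)) fun w =>
        -(para w * diracWith (fun j => star (unit j)) (Δ^[m] f) w)) (kelvinDomain U) := by
  intro x hx
  have hV := isOpen_kelvinDomain hU
  have hF := contDiffOn_star_para_mul (hf.kelvin hU (2 * m - (n + 1 : ℕ)))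
  have hp : ContDiffOn ℝ (2 * m : ℕ) (fun w => (-1 : ℝ) •
      (para w * diracWith (fun j => star (unit j)) f w)) U :=
    (contDiffOn_para_mul (hf.diracWith hU _)).const_smul (-1 : ℝ)
  have hc : ContDiffOn ℝ (2 * m : ℕ) (fun w => (2 * m : ℝ) • f w) U :=
    (hf.of_nat_le (by omega)).const_smul _
  have h1 : EqOn (diracWith unit fun x => star (para x) * kelvin (2 * m - (n + 1 : ℕ)) f x)
      (kelvin (2 * m - (n + 1 : ℕ)) fun w => (2 * m : ℝ) • f w +
        (-1 : ℝ) • (para w * diracWith (fun j => star (unit j)) f w)) (kelvinDomain U) := by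
    intro y hy
    rw [dirac_star_para_mul_kelvin hU (hf.of_nat_le (by omega)) _ hy, kelvin, kelvin]
    push_cast
    module
  have h2 := laplacian_iterate_kelvin (m := m) hU (hc.add hp) hx
  rw [Fintype.card_fin] at h2
  rw [← laplacian_iterate_diracWith hV unit hF hx, laplacian_iterate_congr hV m h1 hx]
  refine h2.trans ?_
  rw [kelvin, kelvin]
  congr 1
  refine (laplacian_iterate_add hU hc hp hx.2).trans ?_
  beta_reduce
  rw [laplacian_iterate_const_smul _ hU (hf.of_nat_le (by omega)) hx.2,
    laplacian_iterate_const_smul _ hU (contDiffOn_para_mul (hf.diracWith hU _)) hx.2]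
  beta_reduce
  rw [laplacian_iterate_para_mul_dirac_star hU hf hx.2]
  module

end Cl

/-! ### The Laplacian under affine conformal maps. -/

section Conformal

open Laplacian Set InnerProductSpace

variable {ι : Type*} [Fintype ι] [DecidableEq ι]
  {G : Type*} [NormedAddCommGroup G] [NormedSpace ℝ G]
  {U : Set (EuclideanSpace ℝ ι)} {f : EuclideanSpace ℝ ι → G} {k m : ℕ}
  {T : EuclideanSpace ℝ ι →L[ℝ] EuclideanSpace ℝ ι} {r : ℝ}

/-- T/r is a linear isometry and carries an orthonormal basis to another; the trace of a bilinear
map does not depend on the orthonormal basis, here through the canonical covariant tensor. -/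
theorem sum_bilin_conformal (hr : 0 < r) (hT : ∀ v, ‖T v‖ = r * ‖v‖)
    (B : EuclideanSpace ℝ ι →ₗ[ℝ] EuclideanSpace ℝ ι →ₗ[ℝ] G) :
    ∑ j, B (T (EuclideanSpace.single j 1)) (T (EuclideanSpace.single j 1)) =
      r ^ 2 • ∑ j, B (EuclideanSpace.single j 1) (EuclideanSpace.single j 1) := by
  let L : EuclideanSpace ℝ ι →ₗᵢ[ℝ] EuclideanSpace ℝ ι :=
    ⟨(r⁻¹ • T).toLinearMap, fun v => by
      change ‖r⁻¹ • T v‖ = ‖v‖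
      rw [norm_smul, hT, Real.norm_of_nonneg (by positivity)]
      field_simp⟩
  have hL (v : EuclideanSpace ℝ ι) : T v = r • L v := by
    change T v = r • r⁻¹ • T v
    rw [smul_smul, mul_inv_cancel₀ hr.ne', one_smul]
  let b := EuclideanSpace.basisFun ι ℝ
  have h := (canonicalCovariantTensor_eq_sum _ (b.map (L.toLinearIsometryEquiv rfl))).symm.trans
    (canonicalCovariantTensor_eq_sum _ b)
  have h' := congrArg (TensorProduct.lift B) h
  simp only [map_sum, TensorProduct.lift.tmul, OrthonormalBasis.map_apply, b,
    LinearIsometry.coe_toLinearIsometryEquiv, EuclideanSpace.basisFun_apply] at h'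
  rw [← h', Finset.smul_sum]
  refine Finset.sum_congr rfl fun j _ => ?_
  rw [hL, map_smul, map_smul, LinearMap.smul_apply, smul_smul, pow_two]

theorem isOpen_affine_preimage (hU : IsOpen U) (t : EuclideanSpace ℝ ι) :
    IsOpen {x | T x + t ∈ U} :=
  hU.preimage (by fun_prop : Continuous fun x => T x + t)

theorem ContDiffOn.comp_affine (hf : ContDiffOn ℝ k f U) (t : EuclideanSpace ℝ ι) :
    ContDiffOn ℝ k (fun x => f (T x + t)) {x | T x + t ∈ U} :=
  hf.comp (T.contDiff.add contDiff_const).contDiffOn fun _ hx => hx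

theorem fderiv_comp_affine {H : Type*} [NormedAddCommGroup H] [NormedSpace ℝ H]
    {g : EuclideanSpace ℝ ι → H} (t x : EuclideanSpace ℝ ι)
    (hg : DifferentiableAt ℝ g (T x + t)) (v : EuclideanSpace ℝ ι) :
    fderiv ℝ (fun x => g (T x + t)) x v = fderiv ℝ g (T x + t) (T v) := by
  have h1 : HasFDerivAt (fun x => T x + t) T x := T.hasFDerivAt.add_const t
  have h2 : HasFDerivAt (fun x => g (T x + t)) ((fderiv ℝ g (T x + t)).comp T) x :=
    HasFDerivAt.comp x hg.hasFDerivAt h1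
  rw [h2.fderiv]
  rfl

theorem laplacian_comp_conformal (hU : IsOpen U) (hr : 0 < r) (hT : ∀ v, ‖T v‖ = r * ‖v‖)
    (t : EuclideanSpace ℝ ι) (hf : ContDiffOn ℝ (2 : ℕ) f U) :
    EqOn (Δ fun x => f (T x + t)) (fun x => r ^ 2 • Δ f (T x + t)) {x | T x + t ∈ U} := by
  intro x hx
  have hV := isOpen_affine_preimage (T := T) hU t
  have hfx := hf.contDiffAt (hU.mem_nhds hx)
  have hd : DifferentiableAt ℝ (fderiv ℝ f) (T x + t) :=
    (hfx.fderiv_right (m := 1) (by norm_cast)).differentiableAt (by simp)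
  have h1 (i : ι) : EqOn (pderivAt i fun x => f (T x + t))
      (fun x => fderiv ℝ f (T x + t) (T (EuclideanSpace.single i 1))) {x | T x + t ∈ U} :=
    fun y hy => fderiv_comp_affine t y (ContDiffOn.differentiableAt_of_isOpen (k := 1) hU hf hy) _
  have h2 (v w : EuclideanSpace ℝ ι) : DifferentiableAt ℝ (fun x => fderiv ℝ f x v) (T x + t) :=
    hd.clm_apply (differentiableAt_const _)
  have h3 (v w : EuclideanSpace ℝ ι) : fderiv ℝ (fun x => fderiv ℝ f x v) (T x + t) w =
      fderiv ℝ (fderiv ℝ f) (T x + t) w v := by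
    rw [fderiv_clm_apply hd (differentiableAt_const _)]
    simp
  rw [laplacian_eqOn hV (hf.comp_affine t) hx]
  beta_reduce
  rw [laplacian_eqOn hU hf hx]
  have h4 (i : ι) : pderivAt i (pderivAt i fun x => f (T x + t)) x =
      fderiv ℝ (fderiv ℝ f) (T x + t) (T (EuclideanSpace.single i 1))
        (T (EuclideanSpace.single i 1)) := by
    rw [pderivAt_congr hV (h1 i) i hx, pderivAt, ← h3]
    exact fderiv_comp_affine (g := fun x => fderiv ℝ f x (T (EuclideanSpace.single i 1))) t x
      (h2 _ 0) _
  simp only [h4]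
  have h5 := sum_bilin_conformal hr hT (fderiv ℝ (fderiv ℝ f) (T x + t)).toLinearMap₁₂
  refine h5.trans (congrArg _ (Finset.sum_congr rfl fun i _ => ?_))
  exact (h3 _ _).symm

theorem laplacian_iterate_comp_conformal (hU : IsOpen U) (hr : 0 < r)
    (hT : ∀ v, ‖T v‖ = r * ‖v‖) (t : EuclideanSpace ℝ ι)
    (hf : ContDiffOn ℝ (2 * m : ℕ) f U) :
    EqOn (Δ^[m] fun x => f (T x + t)) (fun x => (r ^ 2) ^ m • Δ^[m] f (T x + t))
      {x | T x + t ∈ U} := by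
  induction m generalizing f with
  | zero => intro x _; simp
  | succ m ih =>
    intro x hx
    have hV := isOpen_affine_preimage (T := T) hU t
    have hL : ContDiffOn ℝ (2 * m : ℕ) (Δ f) U := ContDiffOn.laplacian hU hf
    rw [Function.iterate_succ_apply, laplacian_iterate_congr hV m
      (laplacian_comp_conformal hU hr hT t (hf.of_nat_le (by omega))) hx,
      laplacian_iterate_const_smul _ hV (hL.comp_affine t) hx]
    beta_reduce
    rw [ih hL hx, smul_smul, pow_succ' _ m]
    rfl

end Conformal

/-! ### Dirac operators under affine conformal maps. -/

namespace Cl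

open Laplacian Set

variable {n : ℕ} {U : Set (EuclideanSpace ℝ (Fin (n + 1)))}
  {f g : EuclideanSpace ℝ (Fin (n + 1)) → Cl n} {k m : ℕ}
  {T : EuclideanSpace ℝ (Fin (n + 1)) →L[ℝ] EuclideanSpace ℝ (Fin (n + 1))} {r : ℝ}

/-- The relation `hq` turns the sum into the trace of (v, w) ↦ b v f'(w) over the vectors T e_j. The
units q are left free so that both D and D̄ are covered. -/
theorem diracWith_comp_conformal (hr : 0 < r) (hT : ∀ v, ‖T v‖ = r * ‖v‖)
    (t : EuclideanSpace ℝ (Fin (n + 1))) {q : Fin (n + 1) → Cl n} {a b : Cl n}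
    (hq : ∀ j, q j * a = b * para (T (EuclideanSpace.single j 1)))
    {x : EuclideanSpace ℝ (Fin (n + 1))} (hf : DifferentiableAt ℝ f (T x + t)) :
    diracWith q (fun x => a * f (T x + t)) x = r ^ 2 • (b * diracWith unit f (T x + t)) := by
  let B : EuclideanSpace ℝ (Fin (n + 1)) →ₗ[ℝ] EuclideanSpace ℝ (Fin (n + 1)) →ₗ[ℝ] Cl n :=
    (LinearMap.mul ℝ (Cl n)).compl₁₂ (LinearMap.mulLeft ℝ b ∘ₗ para)
      (fderiv ℝ f (T x + t)).toLinearMap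
  have hB (v w : EuclideanSpace ℝ (Fin (n + 1))) :
    B v w = b * para v * fderiv ℝ f (T x + t) w := rfl
  have h := sum_bilin_conformal hr hT B
  simp only [hB] at h
  have hd : DifferentiableAt ℝ (fun x => f (T x + t)) x :=
    DifferentiableAt.comp x hf (T.differentiableAt.add_const t)
  have h1 : diracWith q (fun x => a * f (T x + t)) x =
      ∑ j, b * para (T (EuclideanSpace.single j 1)) *
        fderiv ℝ f (T x + t) (T (EuclideanSpace.single j 1)) := by
    refine Finset.sum_congr rfl fun j _ => ?_
    rw [pderivAt_const_mul a j hd, ← mul_assoc, hq, pderivAt, fderiv_comp_affine t x hf]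
  rw [h1, h, diracWith, Finset.mul_sum]
  simp only [mul_assoc]
  rfl

theorem diracWith_laplacian_iterate_comp_conformal (hU : IsOpen U) (hr : 0 < r)
    (hT : ∀ v, ‖T v‖ = r * ‖v‖) (t : EuclideanSpace ℝ (Fin (n + 1)))
    {q : Fin (n + 1) → Cl n} {a b : Cl n}
    (hq : ∀ j, q j * a = b * para (T (EuclideanSpace.single j 1)))
    (hf : ContDiffOn ℝ (2 * m + 1 : ℕ) f U) :
    EqOn (diracWith q (Δ^[m] fun x => a * f (T x + t)))
      (fun x => (r ^ 2) ^ (m + 1) • (b * diracWith unit (Δ^[m] f) (T x + t)))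
      {x | T x + t ∈ U} := by
  intro x hx
  have hV := isOpen_affine_preimage (T := T) hU t
  have hf' : ContDiffOn ℝ (2 * m : ℕ) f U := hf.of_nat_le (by omega)
  have h1 : EqOn (Δ^[m] fun x => a * f (T x + t))
      (fun x => ((r ^ 2) ^ m • a) * Δ^[m] f (T x + t)) {x | T x + t ∈ U} := fun y hy => by
    refine (laplacian_iterate_comp_clm (mulLeftL a) hV (hf'.comp_affine t) hy).trans ?_
    beta_reduce
    rw [laplacian_iterate_comp_conformal hU hr hT t hf' hy, mulLeftL_apply, mul_smul_comm,
      smul_mul_assoc]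
  have hq' (j : Fin (n + 1)) : q j * ((r ^ 2) ^ m • a) =
      ((r ^ 2) ^ m • b) * para (T (EuclideanSpace.single j 1)) := by
    rw [mul_smul_comm, hq, smul_mul_assoc]
  have hd : DifferentiableAt ℝ (Δ^[m] f) (T x + t) :=
    ContDiffOn.differentiableAt_of_isOpen (k := 0) hU
      (ContDiffOn.laplacian_iterate hU (hf.of_nat_le (by omega))) hx
  rw [diracWith_congr hV q h1 hx, diracWith_comp_conformal hr hT t hq' hd, smul_mul_assoc,
    smul_smul, pow_succ' (r ^ 2) m]

end Cl

/-! ### Multiplicativity of the Clifford norm for paravector factors. -/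

namespace Cl

variable {n : ℕ}

theorem e_mul_e_self (i : Fin n) : (e i * e i : Cl n) = -1 := by
  have h := e_mul_e_add i i
  rw [if_pos rfl, ← two_smul ℝ, Algebra.algebraMap_eq_smul_one] at h
  have h2 : (2 : ℝ) • (e i * e i : Cl n) = (2 : ℝ) • (-1) := by rw [h]; module
  exact smul_right_injective _ (two_ne_zero (α := ℝ)) h2

theorem e_mul_e_of_ne {i j : Fin n} (h : i ≠ j) : (e i * e j : Cl n) = -(e j * e i) := by
  have := e_mul_e_add i j
  rw [if_neg h, map_zero] at this
  exact eq_neg_of_add_eq_zero_left this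

theorem prod_e_perm {l l' : List (Fin n)} (h : l.Perm l') (hl : l.Nodup) :
    ∃ ε : ℝ, ε ^ 2 = 1 ∧ ((l.map e).prod : Cl n) = ε • (l'.map e).prod := by
  induction h with
  | nil => exact ⟨1, by simp, by simp⟩
  | cons i _ ih =>
    obtain ⟨ε, h1, h2⟩ := ih (List.nodup_cons.mp hl).2
    exact ⟨ε, h1, by simp [h2]⟩
  | swap i j l =>
    have hij : j ≠ i := by
      rintro rfl
      simp at hl
    refine ⟨-1, by norm_num, ?_⟩
    simp only [List.map_cons, List.prod_cons, ← mul_assoc, e_mul_e_of_ne hij]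
    simp
  | trans h1 _ ih1 ih2 =>
    obtain ⟨ε, h3, h4⟩ := ih1 hl
    obtain ⟨δ, h5, h6⟩ := ih2 (h1.nodup_iff.mp hl)
    exact ⟨ε * δ, by rw [mul_pow, h3, h5, one_mul], by rw [h4, h6, smul_smul]⟩

/-- A repeated generator squares to -1 and a new one is sorted into place by anticommutation; ε² = 1
records that only a sign arises. -/
theorem blade_mul_e (A : Finset (Fin n)) (i : Fin n) :
    ∃ ε : ℝ, ε ^ 2 = 1 ∧ (blade A * e i : Cl n) = ε • blade (symmDiff A {i}) := by
  by_cases hi : i ∈ A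
  · have hA : symmDiff A {i} = A.erase i := by
      ext j
      by_cases h : j = i <;> simp [Finset.mem_symmDiff, h, hi]
    have hp : (A.sort (· ≤ ·)).Perm ((A.erase i).sort (· ≤ ·) ++ [i]) := by
      refine (List.perm_ext_iff_of_nodup (A.sort_nodup _) ?_).mpr fun j => ?_
      · simp only [List.nodup_append, Finset.sort_nodup, List.nodup_singleton, true_and,
          Finset.mem_sort, Finset.mem_erase, List.mem_singleton]
        rintro a ⟨ha, -⟩ b rfl
        exact ha
      · by_cases h : j = i <;> simp [h, hi]
    obtain ⟨ε, h1, h2⟩ := prod_e_perm hp (A.sort_nodup _)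
    refine ⟨-ε, by simpa using h1, ?_⟩
    rw [blade, h2, hA, blade]
    simp [mul_assoc, e_mul_e_self]
  · have hA : symmDiff A {i} = insert i A := by
      ext j
      by_cases h : j = i <;> simp [Finset.mem_symmDiff, h, hi]
    have hp : (A.sort (· ≤ ·) ++ [i]).Perm ((insert i A).sort (· ≤ ·)) := by
      refine (List.perm_ext_iff_of_nodup ?_ (Finset.sort_nodup _ _)).mpr fun j => ?_
      · rw [List.nodup_append]
        refine ⟨A.sort_nodup _, by simp, ?_⟩
        intro a ha b hb
        rw [Finset.mem_sort] at ha
        rw [List.mem_singleton] at hb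
        rintro rfl
        exact hi (hb ▸ ha)
      · simp [or_comm]
    obtain ⟨ε, h1, h2⟩ := prod_e_perm hp (hp.nodup_iff.mpr (Finset.sort_nodup _ _))
    refine ⟨ε, h1, ?_⟩
    rw [hA, blade, blade, ← h2]
    simp

theorem norm_sq_eq (a : Cl n) : ‖a‖ ^ 2 = ∑ A, (bladeBasis n).repr a A ^ 2 := by
  rw [norm_eq, Real.sq_sqrt (by positivity)]
  simp

/-- Right multiplication by a generator permutes the orthonormal basis of blades up to signs, by the
involution A ↦ A ∆ {i}. -/
theorem norm_mul_e (a : Cl n) (i : Fin n) : ‖a * e i‖ = ‖a‖ := by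
  choose ε h1 h2 using fun A : Finset (Fin n) => blade_mul_e A i
  have hσ : Function.Involutive fun A : Finset (Fin n) => symmDiff A {i} := fun A => by
    simp
  have h3 : a * e i = ∑ A, ((bladeBasis n).repr a A * ε A) • bladeBasis n (symmDiff A {i}) := by
    conv_lhs => rw [← (bladeBasis n).sum_repr a]
    simp only [Finset.sum_mul, smul_mul_assoc, bladeBasis_apply, h2, smul_smul]
  have h4 (A : Finset (Fin n)) : (bladeBasis n).repr (a * e i) (symmDiff A {i}) =
      (bladeBasis n).repr a A * ε A := by
    rw [h3]
    simp only [map_sum, map_smul, Module.Basis.repr_self, Finsupp.coe_finsetSum,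
      Finset.sum_apply, Finsupp.smul_apply, Finsupp.single_apply, hσ.injective.eq_iff]
    simp
  have h5 : ‖a * e i‖ ^ 2 = ‖a‖ ^ 2 := by
    rw [norm_sq_eq, norm_sq_eq, ← (Equiv.sum_comp hσ.toPerm _)]
    refine Finset.sum_congr rfl fun A _ => ?_
    rw [Function.Involutive.coe_toPerm, h4, mul_pow, h1, mul_one]
  exact (pow_left_inj₀ (norm_nonneg _) (norm_nonneg _) two_ne_zero).mp h5

theorem norm_components (a : Cl n) : ‖components n a‖ = ‖a‖ := rfl

/-- Right multiplication by e_i is an isometry, so its adjoint is its inverse, right multiplication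
by -e_i. -/
theorem inner_components_mul_e (a b : Cl n) (i : Fin n) :
    inner ℝ (components n (a * e i)) (components n b) =
      inner ℝ (components n a) (components n (b * -e i)) := by
  have h (c d : Cl n) : inner ℝ (components n (c * e i)) (components n (d * e i)) =
      inner ℝ (components n c) (components n d) := by
    rw [real_inner_eq_norm_add_mul_self_sub_norm_mul_self_sub_norm_mul_self_div_two,
      real_inner_eq_norm_add_mul_self_sub_norm_mul_self_sub_norm_mul_self_div_two,
      ← map_add, ← map_add, ← add_mul]
    simp only [norm_components, norm_mul_e]
  rw [← h a]
  simp [mul_assoc, e_mul_e_self]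

theorem inner_components_mul_para (a b : Cl n) (x : EuclideanSpace ℝ (Fin (n + 1))) :
    inner ℝ (components n (a * para x)) (components n b) =
      inner ℝ (components n a) (components n (b * star (para x))) := by
  have hs : star (para x : Cl n) = algebraMap ℝ (Cl n) (x 0) + ∑ i : Fin n, x i.succ • -e i := by
    simp [para_apply, e]
  rw [hs, para_apply]
  simp only [mul_add, map_add, inner_add_left, inner_add_right, Finset.mul_sum, map_sum,
    sum_inner, inner_sum, mul_smul_comm, map_smul, real_inner_smul_left, real_inner_smul_right,
    inner_components_mul_e, Algebra.algebraMap_eq_smul_one, mul_one]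

/-- The adjoint of right multiplication by x is right multiplication by x̄, and x x̄ = ‖x‖². This
splits ‖c(x + w)‖. -/
theorem norm_mul_para (a : Cl n) (x : EuclideanSpace ℝ (Fin (n + 1))) :
    ‖a * para x‖ = ‖a‖ * ‖x‖ := by
  have h : ‖a * para x‖ ^ 2 = (‖a‖ * ‖x‖) ^ 2 := by
    rw [← norm_components, ← real_inner_self_eq_norm_sq, inner_components_mul_para, mul_assoc,
      para_mul_star, Algebra.algebraMap_eq_smul_one, mul_smul_comm, mul_one, map_smul,
      real_inner_smul_right, real_inner_self_eq_norm_sq, norm_components]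
    ring
  exact (pow_left_inj₀ (norm_nonneg _) (by positivity) two_ne_zero).mp h

end Cl

/-! ### Decomposition of Möbius maps and the transformation law. -/

namespace Cl

open Laplacian Set

variable {n : ℕ} {U : Set (EuclideanSpace ℝ (Fin (n + 1)))}
  {f : EuclideanSpace ℝ (Fin (n + 1)) → Cl n} {m : ℕ} {k : ℤ}

theorem para_injective : Function.Injective (para (n := n)) :=
  Function.LeftInverse.injective paraPart_para

theorem exists_para_eq_of_linear {L : EuclideanSpace ℝ (Fin (n + 1)) →ₗ[ℝ] Cl n}
    (hL : ∀ x, L x ∈ LinearMap.range (para (n := n))) :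
    ∃ T : EuclideanSpace ℝ (Fin (n + 1)) →L[ℝ] EuclideanSpace ℝ (Fin (n + 1)),
      ∀ x, para (T x) = L x := by
  choose T hT using hL
  let T' : EuclideanSpace ℝ (Fin (n + 1)) →ₗ[ℝ] EuclideanSpace ℝ (Fin (n + 1)) :=
    { toFun := T
      map_add' := fun x y => para_injective (by simp [hT])
      map_smul' := fun c x => para_injective (by simp [hT]) }
  exact ⟨T'.toContinuousLinearMap, hT⟩

/-- Conjugation of paravectors. -/
theorem exists_conj (n : ℕ) :
    ∃ C : EuclideanSpace ℝ (Fin (n + 1)) →L[ℝ] EuclideanSpace ℝ (Fin (n + 1)),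
      (∀ x, (para (C x) : Cl n) = star (para x)) ∧ ∀ x, ‖C x‖ = ‖x‖ := by
  let L : EuclideanSpace ℝ (Fin (n + 1)) →ₗ[ℝ] Cl n :=
    { toFun := fun x => star (para x)
      map_add' := fun x y => by simp
      map_smul' := fun c x => by simp }
  obtain ⟨C, hC⟩ := exists_para_eq_of_linear (L := L) star_para_mem
  refine ⟨C, hC, fun x => ?_⟩
  have h := para_mul_star (C x)
  rw [hC, show L x = star (para x) from rfl, star_star, star_mul_para] at h
  have h' := (algebraMap ℝ (Cl n)).injective h
  exact ((pow_left_inj₀ (norm_nonneg _) (norm_nonneg _) two_ne_zero).mp h').symm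

theorem rev_star (a : Cl n) : rev (star a) = star (rev a) := by
  simp only [rev, CliffordAlgebra.star_def, CliffordAlgebra.reverse_involute_commute.eq]

theorem rev_smul (r : ℝ) (a : Cl n) : rev (r • a) = r • rev a := map_smul _ _ _

theorem rev_one : rev (1 : Cl n) = 1 := by simp [rev]

theorem IsParaProd.exists_norm {c : Cl n} (hc : IsParaProd c) (h0 : c ≠ 0) :
    ∃ ρ : ℝ, 0 < ρ ∧ c * star c = ρ • 1 ∧ star c * c = ρ • 1 := by
  obtain ⟨l, rfl⟩ := hc
  induction l with
  | nil => exact ⟨1, one_pos, by simp, by simp⟩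
  | cons p l ih =>
    rw [List.map_cons, List.prod_cons] at h0 ⊢
    obtain ⟨ρ, h1, h2, h3⟩ := ih (right_ne_zero_of_mul h0)
    have hp : p ≠ 0 := by
      rintro rfl
      simp at h0
    have hp' : 0 < ‖p‖ := norm_pos_iff.mpr hp
    refine ⟨‖p‖ ^ 2 * ρ, by positivity, ?_, ?_⟩
    · rw [star_mul, mul_assoc, ← mul_assoc _ (star _), h2, smul_mul_assoc, one_mul, mul_smul_comm,
        para_mul_star, Algebra.algebraMap_eq_smul_one, smul_smul, mul_comm]
    · rw [star_mul, mul_assoc, ← mul_assoc (star (para p)), star_mul_para, ← Algebra.smul_def,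
        mul_smul_comm, h3, smul_smul]

/-- The conformal linear map `x ↦ c'~ x c'`, where `c'` is the inverse of a product of
paravectors `c`. -/
theorem IsParaProd.exists_conformal {c : Cl n} (hc : IsParaProd c) (h0 : c ≠ 0) :
    ∃ (c' : Cl n) (T : EuclideanSpace ℝ (Fin (n + 1)) →L[ℝ] EuclideanSpace ℝ (Fin (n + 1)))
      (r : ℝ), c * c' = 1 ∧ c' * c = 1 ∧ 0 < r ∧ (∀ x, ‖T x‖ = r * ‖x‖) ∧
      (∀ x, para (T x) = rev c' * para x * c') ∧
      ∀ x, para x * star c = (r⁻¹ • rev c) * para (T x) := by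
  obtain ⟨c', h1, h2, h3⟩ := hc.inv h0
  obtain ⟨ρ, hρ, h4, h5⟩ := hc.exists_norm h0
  let L : EuclideanSpace ℝ (Fin (n + 1)) →ₗ[ℝ] Cl n :=
    LinearMap.mulRight ℝ c' ∘ₗ LinearMap.mulLeft ℝ (rev c') ∘ₗ para
  obtain ⟨T, hT⟩ := exists_para_eq_of_linear (L := L) h3
  replace hT (x : EuclideanSpace ℝ (Fin (n + 1))) : para (T x) = rev c' * para x * c' := hT x
  -- The inverse c' is ρ⁻¹ times the conjugate of c, which makes the conformal factor of x ↦ c'~ x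
  -- c' equal to ρ⁻¹.
  have hs : star c = ρ • c' := by
    rw [← mul_one (star c), ← h1, ← mul_assoc, h5, smul_mul_assoc, one_mul]
  have hc' : c' = ρ⁻¹ • star c := by rw [hs, smul_smul, inv_mul_cancel₀ hρ.ne', one_smul]
  have hs' : star c' = ρ⁻¹ • c := by rw [hc', star_smul_real, star_star]
  have h6 : c' * star c' = ρ⁻¹ • 1 := by rw [hs', mul_smul_comm, h2]
  have h7 : star c' * c' = ρ⁻¹ • 1 := by rw [hs', smul_mul_assoc, h1]
  refine ⟨c', T, ρ⁻¹, h1, h2, inv_pos.mpr hρ, fun x => ?_, hT, fun x => ?_⟩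
  · have h := para_mul_star (T x)
    rw [hT, star_mul, star_mul, mul_assoc, ← mul_assoc c', h6, smul_mul_assoc, one_mul,
      mul_smul_comm, ← mul_assoc, mul_assoc (rev c'), para_mul_star, ← Algebra.commutes, mul_assoc,
      ← rev_star, ← rev_mul, h7, rev_smul, rev_one, ← Algebra.algebraMap_eq_smul_one,
      Algebra.smul_def, ← map_mul, ← map_mul] at h
    have h' := (algebraMap ℝ (Cl n)).injective h
    refine (pow_left_inj₀ (norm_nonneg _) (by positivity) two_ne_zero).mp ?_
    rw [← h']
    ring
  · rw [hT, inv_inv, hs, mul_smul_comm, smul_mul_assoc, ← mul_assoc, ← mul_assoc, ← rev_mul, h2,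
      rev_one, one_mul]

/-- `f` is of class `C^{2m+1}` with `D Δᵐ f = 0` on the open set `U`. -/
structure IsPolymonogenic (m : ℕ) (U : Set (EuclideanSpace ℝ (Fin (n + 1))))
    (f : EuclideanSpace ℝ (Fin (n + 1)) → Cl n) : Prop where
  isOpen : IsOpen U
  contDiffOn : ContDiffOn ℝ (2 * m + 1 : ℕ) f U
  dirac_eq_zero : ∀ x ∈ U, diracWith unit (Δ^[m] f) x = 0

theorem IsPolymonogenic.congr {g : EuclideanSpace ℝ (Fin (n + 1)) → Cl n}
    (hf : IsPolymonogenic m U f) (h : EqOn g f U) : IsPolymonogenic m U g where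
  isOpen := hf.isOpen
  contDiffOn := hf.contDiffOn.congr h
  dirac_eq_zero x hx := by
    rw [diracWith_congr hf.isOpen _ (laplacian_iterate_congr hf.isOpen m h) hx,
      hf.dirac_eq_zero x hx]

theorem IsPolymonogenic.comp_conformal (hf : IsPolymonogenic m U f)
    {T : EuclideanSpace ℝ (Fin (n + 1)) →L[ℝ] EuclideanSpace ℝ (Fin (n + 1))} {r : ℝ} (hr : 0 < r)
    (hT : ∀ v, ‖T v‖ = r * ‖v‖) (t : EuclideanSpace ℝ (Fin (n + 1))) {a b : Cl n}
    (hq : ∀ x, para x * a = b * para (T x)) :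
    IsPolymonogenic m {x | T x + t ∈ U} (fun x => a * f (T x + t)) where
  isOpen := isOpen_affine_preimage hf.isOpen t
  contDiffOn := contDiffOn_const_mul a (hf.contDiffOn.comp_affine t)
  dirac_eq_zero x hx := by
    rw [diracWith_laplacian_iterate_comp_conformal hf.isOpen hr hT t (q := unit) (fun j => hq _)
      hf.contDiffOn hx]
    beta_reduce
    rw [hf.dirac_eq_zero _ hx, mul_zero, smul_zero]

/-- Because T intertwines the conjugate units with the units, z ↦ a f(Tz + t) is annihilated by
D̄Δ^m; the inversion then leads back to D. -/
theorem IsPolymonogenic.comp_anticonformal (hf : IsPolymonogenic m U f)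
    {T : EuclideanSpace ℝ (Fin (n + 1)) →L[ℝ] EuclideanSpace ℝ (Fin (n + 1))} {r : ℝ} (hr : 0 < r)
    (hT : ∀ v, ‖T v‖ = r * ‖v‖) (t : EuclideanSpace ℝ (Fin (n + 1))) {a b : Cl n}
    (hq : ∀ x, star (para x) * a = b * para (T x)) :
    IsPolymonogenic m (kelvinDomain {x | T x + t ∈ U})
      (fun x => star (para x) * kelvin (2 * m - (n + 1 : ℕ)) (fun z => a * f (T z + t)) x) := by
  have hV := isOpen_affine_preimage (T := T) hf.isOpen t
  have hg := contDiffOn_const_mul a (hf.contDiffOn.comp_affine (T := T) t)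
  refine ⟨isOpen_kelvinDomain hV, contDiffOn_star_para_mul (hg.kelvin hV _), fun x hx => ?_⟩
  rw [dirac_laplacian_iterate_star_para_mul_kelvin hV hg hx, kelvin,
    diracWith_laplacian_iterate_comp_conformal hf.isOpen hr hT t (q := fun j => star (unit j))
      (fun j => hq _)
      hf.contDiffOn hx.2]
  beta_reduce
  rw [hf.dirac_eq_zero _ hx.2]
  simp

theorem IsPolymonogenic.const_smul_comp_add (hf : IsPolymonogenic m U f) (κ : ℝ)
    (t : EuclideanSpace ℝ (Fin (n + 1))) :
    IsPolymonogenic m {x | x + t ∈ U} (fun x => κ • f (x + t)) := by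
  have h := hf.comp_conformal (T := ContinuousLinearMap.id ℝ _) one_pos (fun v => by simp) t
    (a := κ • 1) (b := κ • 1) (fun x => by simp)
  simpa using h

theorem denom_eq_of_eq_zero {M : Matrix (Fin 2) (Fin 2) (Cl n)} (hc : M 1 0 = 0)
    (x : EuclideanSpace ℝ (Fin (n + 1))) : denom M x = M 1 1 := by
  simp [denom, hc]

/-- The Möbius transformation is affine when `c = 0`. -/
theorem exists_affine_of_eq_zero {M : Matrix (Fin 2) (Fin 2) (Cl n)} (hM : M ∈ SAV n)
    (hc : M 1 0 = 0) :
    M 1 1 ≠ 0 ∧ ∃ (T : EuclideanSpace ℝ (Fin (n + 1)) →L[ℝ] EuclideanSpace ℝ (Fin (n + 1)))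
      (t : EuclideanSpace ℝ (Fin (n + 1))) (r : ℝ), 0 < r ∧ (∀ x, ‖T x‖ = r * ‖x‖) ∧
      (∀ x, para x * star (M 1 1) = (r⁻¹ • rev (M 1 1)) * para (T x)) ∧
      ∀ x, moebius M x = T x + t := by
  obtain ⟨hG, hdet⟩ := hM
  have hz : rev (0 : Cl n) = 0 := by simp [rev]
  rw [hc, hz, mul_zero, sub_zero] at hdet
  have hd : M 1 1 ≠ 0 := fun h => by
    rw [h, hz, mul_zero] at hdet
    exact zero_ne_one hdet
  obtain ⟨d', T, r, h1, h2, hr, hT, hpT, hq⟩ := (hG.prod_para 1 1).exists_conformal hd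
  obtain ⟨t, ht⟩ := hG.para_of_eq hc
  refine ⟨hd, T, t, r, hr, hT, hq, fun x => ?_⟩
  have ha : M 0 0 = rev d' := by
    rw [← mul_one (M 0 0), ← rev_mul_rev_eq_one h2, ← mul_assoc, hdet, one_mul]
  rw [← paraPart_para (T x + t), moebius, denom_eq_of_eq_zero hc, map_add, ht, hpT,
    ring_inverse_eq h1 h2, ha, add_mul]

/-- The Möbius transformation as a composition of the inversion with affine conformal maps when
`c ≠ 0`. -/
theorem exists_inversion_of_ne_zero {M : Matrix (Fin 2) (Fin 2) (Cl n)} (hM : M ∈ SAV n)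
    (hc : M 1 0 ≠ 0) :
    ∃ (T : EuclideanSpace ℝ (Fin (n + 1)) →L[ℝ] EuclideanSpace ℝ (Fin (n + 1)))
      (w t : EuclideanSpace ℝ (Fin (n + 1))) (r : ℝ) (b : Cl n), 0 < r ∧ (∀ x, ‖T x‖ = r * ‖x‖) ∧
      (∀ x, star (para x) * star (M 1 0) = b * para (T x)) ∧
      (∀ x, denom M x = M 1 0 * para (x + w)) ∧
      ∀ x, x + w ≠ 0 → moebius M x = T (sphereInv (x + w)) + t := by
  obtain ⟨hG, hdet⟩ := hM
  obtain ⟨c', S, r, h1, h2, hr, hS, hpS, hq⟩ := (hG.prod_para 1 0).exists_conformal hc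
  obtain ⟨C, hC, hCn⟩ := exists_conj n
  obtain ⟨⟨t, ht⟩, ⟨w, hw⟩⟩ := hG.para_of_ne hc
  rw [ring_inverse_eq h1 h2] at ht hw
  have hd : M 1 1 = M 1 0 * para w := by rw [hw, ← mul_assoc, h1, one_mul]
  have hden (x : EuclideanSpace ℝ (Fin (n + 1))) : denom M x = M 1 0 * para (x + w) := by
    rw [denom, map_add, mul_add, ← hd]
  -- Here M<x> = ac⁻¹ - c'~ (x + w)⁻¹ c' with c' = c⁻¹, and (x + w)⁻¹ is the conjugate of (x + w)*.
  -- Hence T is minus the sandwich S after the conjugation C.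
  refine ⟨-(S.comp C), w, t, r, -(r⁻¹ • rev (M 1 0)), hr, fun x => ?_, fun x => ?_, hden,
    fun x hx => ?_⟩
  · simp [hS, hCn]
  · rw [← hC, hq]
    simp
  · have hn : ‖x + w‖ ^ 2 ≠ 0 := by simpa using hx
    have hz : ‖x + w‖ ^ (-2 : ℤ) = (‖x + w‖ ^ 2)⁻¹ := by rw [zpow_neg]; norm_cast
    have hi : (para (C (sphereInv (x + w))) : Cl n) =
        (‖x + w‖ ^ 2)⁻¹ • star (para (x + w)) := by
      rw [hC, sphereInv, map_smul, star_smul_real, hz]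
    have hv1 : (para (x + w) : Cl n) * para (C (sphereInv (x + w))) = 1 := by
      rw [hi, mul_smul_comm, para_mul_star, Algebra.algebraMap_eq_smul_one, smul_smul,
        inv_mul_cancel₀ hn, one_smul]
    have hv2 : (para (C (sphereInv (x + w))) : Cl n) * para (x + w) = 1 := by
      rw [hi, smul_mul_assoc, star_mul_para, Algebra.algebraMap_eq_smul_one, smul_smul,
        inv_mul_cancel₀ hn, one_smul]
    have i1 : denom M x * (para (C (sphereInv (x + w))) * c') = 1 := by
      rw [hden, mul_assoc, ← mul_assoc (para (x + w)), hv1, one_mul, h1]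
    have i2 : para (C (sphereInv (x + w))) * c' * denom M x = 1 := by
      rw [hden, mul_assoc, ← mul_assoc c', h2, one_mul, hv2]
    -- With d = cw, the determinant condition reads (aw - b) c~ = 1.
    have hb : M 0 1 = M 0 0 * para w - rev c' := by
      rw [hd, rev_mul, rev_para] at hdet
      have : (M 0 0 * para w - M 0 1) * rev (M 1 0) * rev c' = rev c' := by
        rw [sub_mul, mul_assoc (M 0 0), hdet, one_mul]
      rw [mul_assoc, rev_mul_rev_eq_one h2, mul_one] at this
      rw [← this]
      abel
    have hnum : M 0 0 * para x + M 0 1 = M 0 0 * para (x + w) - rev c' := by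
      rw [hb, map_add, mul_add]
      abel
    rw [← paraPart_para (_ + t), moebius, ring_inverse_eq i1 i2, hnum, sub_mul, mul_assoc,
      ← mul_assoc (para (x + w)), hv1, one_mul, ← ht, map_add, ← mul_assoc, ← hpS]
    congr 1
    simp
    abel

theorem moebius_preimage_eq {M : Matrix (Fin 2) (Fin 2) (Cl n)} (hc : M 1 0 ≠ 0)
    {T : EuclideanSpace ℝ (Fin (n + 1)) →L[ℝ] EuclideanSpace ℝ (Fin (n + 1))}
    {w t : EuclideanSpace ℝ (Fin (n + 1))} (hden : ∀ x, denom M x = M 1 0 * para (x + w))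
    (hm : ∀ x, x + w ≠ 0 → moebius M x = T (sphereInv (x + w)) + t) :
    {x | denom M x ≠ 0 ∧ moebius M x ∈ U} = {x | x + w ∈ kelvinDomain {z | T z + t ∈ U}} := by
  ext x
  have h : denom M x ≠ 0 ↔ x + w ≠ 0 := by
    rw [← norm_ne_zero_iff, hden, norm_mul_para, mul_ne_zero_iff, norm_ne_zero_iff,
      norm_ne_zero_iff, and_iff_right hc]
  simp only [kelvinDomain, mem_ofPred_eq, h]
  exact and_congr_right fun hx => by rw [hm x hx]

theorem isOpen_moebius_preimage {M : Matrix (Fin 2) (Fin 2) (Cl n)} (hM : M ∈ SAV n)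
    (hU : IsOpen U) : IsOpen {x | denom M x ≠ 0 ∧ moebius M x ∈ U} := by
  by_cases hc : M 1 0 = 0
  · obtain ⟨hd, T, t, -, -, -, -, hm⟩ := exists_affine_of_eq_zero hM hc
    simp only [denom_eq_of_eq_zero hc, hd, hm, ne_eq, not_false_eq_true, true_and]
    exact isOpen_affine_preimage hU t
  · obtain ⟨T, w, t, -, -, -, -, -, hden, hm⟩ := exists_inversion_of_ne_zero hM hc
    rw [moebius_preimage_eq hc hden hm]
    exact (isOpen_kelvinDomain (isOpen_affine_preimage hU t)).preimage
      (continuous_id.add continuous_const)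

theorem IsPolymonogenic.comp_moebius (hf : IsPolymonogenic m U f)
    {M : Matrix (Fin 2) (Fin 2) (Cl n)} (hM : M ∈ SAV n) :
    IsPolymonogenic m {x | denom M x ≠ 0 ∧ moebius M x ∈ U}
      (fun x => (‖denom M x‖ ^ ((n : ℤ) + 1 - 2 * m))⁻¹ •
        (star (denom M x) * f (moebius M x))) := by
  by_cases hc : M 1 0 = 0
  · obtain ⟨hd, T, t, r, hr, hT, hq, hm⟩ := exists_affine_of_eq_zero hM hc
    simp only [denom_eq_of_eq_zero hc, hd, hm, ne_eq, not_false_eq_true, true_and,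
      ← smul_mul_assoc]
    exact hf.comp_conformal hr hT t
      (b := (‖M 1 1‖ ^ ((n : ℤ) + 1 - 2 * m))⁻¹ • r⁻¹ • rev (M 1 1)) fun x => by
        simp only [mul_smul_comm, hq, smul_mul_assoc]
  · obtain ⟨T, w, t, r, b, hr, hT, hq, hden, hm⟩ := exists_inversion_of_ne_zero hM hc
    rw [moebius_preimage_eq hc hden hm]
    refine ((hf.comp_anticonformal hr hT t hq).const_smul_comp_add
      (‖M 1 0‖ ^ ((n : ℤ) + 1 - 2 * m))⁻¹ w).congr fun x hx => ?_
    have he : (2 * m - (n + 1 : ℕ) : ℤ) = -((n : ℤ) + 1 - 2 * m) := by push_cast; ring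
    beta_reduce
    -- The power of ‖c‖ goes into the scalar factor, that of ‖x + w‖ is the Kelvin weight, and the
    -- conjugate of c(x + w) puts the conjugate of x + w in front.
    rw [hm x hx.1, hden, norm_mul_para, mul_zpow, mul_inv, mul_smul, star_mul, kelvin, he, zpow_neg,
      mul_smul_comm, mul_assoc]

theorem isKHolomorphicCliffordian_of_nonneg (m : ℕ) (U : Set (EuclideanSpace ℝ (Fin (n + 1))))
    (f : EuclideanSpace ℝ (Fin (n + 1)) → Cl n) :
    IsKHolomorphicCliffordian (2 * m : ℤ) U f ↔ IsPolymonogenic m U f := by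
  have h1 : (2 * m : ℤ).toNat = 2 * m := by omega
  have h2 : (2 * m / 2 : ℤ).toNat = m := by omega
  have h3 : (0 : ℤ) ≤ 2 * m := by positivity
  rw [IsKHolomorphicCliffordian, h1, h2]
  simp only [h3, true_and, h3.not_gt, false_and, or_false]
  exact ⟨fun h => ⟨h.1, h.2.1, h.2.2⟩, fun h => ⟨h.1, h.2, h.3⟩⟩

/-- For negative `k`, a `k`-holomorphic Cliffordian function vanishes, because a monogenic function
of class `C²` is harmonic. -/
theorem IsKHolomorphicCliffordian.eq_zero_of_neg (hk : Even k) (hk0 : k < 0)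
    (hf : IsKHolomorphicCliffordian k U f) : ∀ x ∈ U, f x = 0 := by
  obtain ⟨hU, ⟨h, -⟩ | ⟨-, g, hg, hgf, hgD⟩⟩ := hf
  · omega
  -- Evenness forces k ≤ -2, so the integer quotient is at least 1 and g is of class C².
  obtain ⟨j, hj⟩ : ∃ j : ℕ, (-k / 2).toNat = j + 1 := ⟨(-k / 2).toNat - 1, by
    obtain ⟨a, ha⟩ := hk
    omega⟩
  have hg2 : ContDiffOn ℝ (2 : ℕ) g U := hg.of_nat_le (by omega)
  have hL : EqOn (Δ g) (fun _ => 0) U := fun x hx => by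
    rw [← diracWith_diracWith hU star_unit_mul_unit_add hg2 hx,
      diracWith_congr hU _ (f := diracWith unit g) (g := fun _ => 0) hgD hx]
    simp [diracWith, pderivAt]
  have h0 : ∀ i : ℕ, Δ^[i] (fun _ : EuclideanSpace ℝ (Fin (n + 1)) => (0 : Cl n)) = fun _ => 0 := by
    intro i
    induction i with
    | zero => rfl
    | succ i ih =>
      rw [Function.iterate_succ_apply, InnerProductSpace.laplacian_const]
      exact ih
  intro x hx
  rw [← hgf x hx, hj, laplacePow, Function.iterate_succ_apply,
    laplacian_iterate_congr hU j hL hx, h0]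

/-- The right inverse in the definition may be taken to be g = 0. -/
theorem isKHolomorphicCliffordian_of_neg (hk0 : k < 0) (hU : IsOpen U)
    (hf : ∀ x ∈ U, f x = 0) : IsKHolomorphicCliffordian k U f := by
  refine ⟨hU, Or.inr ⟨hk0, fun _ => 0, contDiffOn_const, fun x hx => ?_, fun x _ => ?_⟩⟩
  · rw [hf x hx, laplacePow]
    generalize (-k / 2).toNat = i
    induction i with
    | zero => rfl
    | succ i ih =>
      rw [Function.iterate_succ_apply, InnerProductSpace.laplacian_const]
      exact ih
  · simp [dirac]

end Cl

theorem theorem3 (n : ℕ) (k : ℤ) (hk : Even k) (M : Matrix (Fin 2) (Fin 2) (Cl n))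
    (hM : M ∈ Cl.SAV n) (U : Set (EuclideanSpace ℝ (Fin (n + 1))))
    (f : EuclideanSpace ℝ (Fin (n + 1)) → Cl n)
    (hf : Cl.IsKHolomorphicCliffordian k U f) :
    Cl.IsKHolomorphicCliffordian k
      {x : EuclideanSpace ℝ (Fin (n + 1)) | Cl.denom M x ≠ 0 ∧ Cl.moebius M x ∈ U}
      (fun x => (‖Cl.denom M x‖ ^ ((n : ℤ) + 1 - k))⁻¹ •
        (star (Cl.denom M x) * f (Cl.moebius M x))) := by
  rcases lt_or_ge k 0 with hk0 | hk0
  · refine Cl.isKHolomorphicCliffordian_of_neg hk0 (Cl.isOpen_moebius_preimage hM hf.1)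
      fun x hx => ?_
    rw [hf.eq_zero_of_neg hk hk0 _ hx.2, mul_zero, smul_zero]
  · obtain ⟨m, rfl⟩ : ∃ m : ℕ, k = 2 * m := ⟨(k / 2).toNat, by
      obtain ⟨a, ha⟩ := hk
      omega⟩
    rw [Cl.isKHolomorphicCliffordian_of_nonneg] at hf ⊢
    exact hf.comp_moebius hM
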